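/- Let $J=\mathrm{diag}(J_1,J_2,J_3)$ with $J_1,J_2,J_3>0$ be the inertia matrix of a rigid body, let $\mathring a\in\mathbb R^3$ be a unit vector, let $I$ be $\mathbb R$ or an open or closed half-line unbounded above, and let $t_0\in I$. For $x\in\mathbb R^3$ let $[x]$ be the matrix with $[x]y=x\times y$. For a solution $(R,\omega)$ on $I$, with $R(t)\in SO(3)$ and $\omega(t)\in\mathbb R^3$, of the free-rotation dynamics $$\dot R=R[\omega],\qquad \dot\omega=J^{-1}(J\omega\times\omega),$$ put $a(t)=R(t)^T\mathring a$. Say that the persistent excitation (PE) assumption holds if there are $T>0$ and $0<\mu<1$ such that $\frac1T\int_t^{t+T}[a(s)]^T[a(s)]\,ds\ge\mu\,\mathrm{Id}$ (as symmetric matrices) for all $t\in I$. Call a vector aligned with $\mathring a$ if it is a real multiple of $\mathring a$. Then: 1. For almost all initial conditions $(R_0,\omega_0)\in SO(3)\times\mathbb R^3$ (with respect to the product of Haar and Lebesgue measure), every solution with $(R(t_0),\omega(t_0))=(R_0,\omega_0)$ satisfies the PE assumption. 2. A solution fails the PE assumption exactly in the following cases: (i) $\omega(t_0)$ is zero or an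 eigenvector of $J$, and $R(t_0)J\omega(t_0)$ is aligned with $\mathring a$; or (ii) $J_1,J_2,J_3$ are pairwise distinct and, with the axes numbered so that $J_1>J_2>J_3$, the coordinates of $\omega(t_0)$ satisfy $$|\omega_1(t_0)|=\sqrt{\frac{J_3(J_2-J_3)}{J_1(J_1-J_2)}}\;|\omega_3(t_0)|,$$ and $R(t_0)J\omega(t_0)$ is aligned with $\mathring a$. -/

import Mathlib

open Matrix MeasureTheory

namespace RigidBody

/-- The group of rotation matrices of `ℝ³`, with the Borel σ-algebra of its usual topology. -/
abbrev SO3 : Type := Matrix.specialOrthogonalGroup (Fin 3) ℝ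

instance : MeasurableSpace SO3 := borel SO3

instance : BorelSpace SO3 := ⟨rfl⟩

/-- The cross-product matrix `[x]`. -/
def skew (x : Fin 3 → ℝ) : Matrix (Fin 3) (Fin 3) ℝ :=
  !![0, -x 2, x 1; x 2, 0, -x 0; -x 1, x 0, 0]

theorem skew_mulVec (x y : Fin 3 → ℝ) : skew x *ᵥ y = crossProduct x y := by
  ext i
  fin_cases i <;> simp [skew, Matrix.mulVec, dotProduct, Fin.sum_univ_three, cross_apply] <;> ring

/-- `(R, ω)` solves the attitude equation `Ṙ = R [ω]` and the Euler equations
`ω̇ = J⁻¹ (J ω × ω + τ)` on the time interval `I`, for the inertia matrix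
`diag (J 0, J 1, J 2)` and the external torque `τ`; the derivative of `R` is taken entrywise. -/
structure IsSolution (J : Fin 3 → ℝ) (τ : ℝ → Fin 3 → ℝ) (I : Set ℝ)
    (R : ℝ → Matrix (Fin 3) (Fin 3) ℝ) (ω : ℝ → Fin 3 → ℝ) : Prop where
  rotation : ∀ t ∈ I, R t ∈ Matrix.specialOrthogonalGroup (Fin 3) ℝ
  attitude : ∀ t ∈ I, ∀ i j : Fin 3,
    HasDerivWithinAt (fun s => R s i j) ((R t * skew (ω t)) i j) I t
  euler : ∀ t ∈ I, HasDerivWithinAt ω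
    ((Matrix.diagonal J)⁻¹ *ᵥ (crossProduct (Matrix.diagonal J *ᵥ ω t) (ω t) + τ t)) I t

/-- Entrywise integral of a matrix-valued function over `[s, t]`. -/
noncomputable def matrixIntegral (F : ℝ → Matrix (Fin 3) (Fin 3) ℝ) (s t : ℝ) :
    Matrix (Fin 3) (Fin 3) ℝ :=
  Matrix.of fun i j => ∫ r in s..t, F r i j

/-- Persistent excitation at all times of `I`: for some `T > 0` and `0 < μ < 1`, the inequality
`(1 / T) ∫ₜᵗ⁺ᵀ [a(s)]ᵀ [a(s)] ds ≥ μ • 1` between symmetric matrices holds for all `t ∈ I`. -/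
def PersistentlyExciting (I : Set ℝ) (a : ℝ → Fin 3 → ℝ) : Prop :=
  ∃ T μ : ℝ, 0 < T ∧ 0 < μ ∧ μ < 1 ∧ ∀ t ∈ I,
    ((1 / T) • matrixIntegral (fun s => (skew (a s))ᵀ * skew (a s)) t (t + T)
      - μ • (1 : Matrix (Fin 3) (Fin 3) ℝ)).PosSemidef

/-- `x` is aligned with (a scalar multiple of) the unit vector `y`. -/
def Aligned (x y : Fin 3 → ℝ) : Prop := ∃ c : ℝ, x = c • y

/-- `ω₀` lies in an eigenspace of `diag (J 0, J 1, J 2)`, that is, it is zero or an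
eigenvector. -/
def InEigenspace (J ω₀ : Fin 3 → ℝ) : Prop := ∃ c : ℝ, Matrix.diagonal J *ᵥ ω₀ = c • ω₀

/-- The moments of inertia are distinct and `ω₀` lies on the singular set; `σ` lists the principal
axes by decreasing moment of inertia. -/
def OnSingularSet (J ω₀ : Fin 3 → ℝ) : Prop :=
  ∃ σ : Equiv.Perm (Fin 3), J (σ 0) > J (σ 1) ∧ J (σ 1) > J (σ 2) ∧
    |ω₀ (σ 0)| =
      √(J (σ 2) * (J (σ 1) - J (σ 2)) / (J (σ 0) * (J (σ 0) - J (σ 1)))) * |ω₀ (σ 2)|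

end RigidBody

/-! In the body frame the problem is autonomous: `a' = a × ω`, `ω' = J⁻¹(Jω × ω)`, with first
integrals `⟨ω, Jω⟩`, `|Jω|²` and `⟨Jω, a⟩`. The form of `[a]ᵀ[a]` at `x` is `|a × x|²`, so PE says
that `a` stays uniformly away, in mean, from every fixed line.

If PE fails, there are windows of length one on which `a` is ever closer in mean to a line.
Trajectories are bounded and Lipschitz, so Barbalat-type arguments make `a × ω` and its derivative
uniformly small on these windows. A limit state `(b, w)` then has `b` parallel to both `w` and the
Euler field at `w` (`exists_limit_state`), which forces `w` to be zero or an eigenvector of `J`,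
with `Jw = k b` (`eigenvector_of_stationary`). The first integrals carry this back to `t₀`: they
give `|Jω - k a|² = 0`, hence alignment, and `∑ Jᵢ (c - Jᵢ) ωᵢ² = 0` for a moment of inertia `c`.
For extremal `c` this form is semidefinite and leaves only eigenvectors; for `c` strictly in the
middle it is the singular set.

Conversely, alignment `Jω = k a` persists in time, so for `k ≠ 0` the direction converges as soon as
`ω` does. On the level sets above `ω` is constant or runs on a separatrix to the middle axis
(`tendsto_of_separatrix`), and a convergent direction is not PE.

The generic statement needs only that failure forces alignment, which for each fixed rotation
confines `ω` to a proper linear subspace. -/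

namespace RigidBody

/-! ### Body-frame equations and first integrals. -/

/-- The vector field of the torque-free Euler equations. -/
noncomputable def eulerField (J w : Fin 3 → ℝ) : Fin 3 → ℝ :=
  ![(J 1 - J 2) * w 1 * w 2 / J 0, (J 2 - J 0) * w 2 * w 0 / J 1, (J 0 - J 1) * w 0 * w 1 / J 2]

theorem eulerField_eq (J : Fin 3 → ℝ) (hJ : ∀ i, 0 < J i) (w : Fin 3 → ℝ) :
    (Matrix.diagonal J)⁻¹ *ᵥ (crossProduct (Matrix.diagonal J *ᵥ w) w + 0) = eulerField J w := by
  have h : (Matrix.diagonal J)⁻¹ = Matrix.diagonal (fun i => (J i)⁻¹) := by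
    apply Matrix.inv_eq_right_inv
    rw [Matrix.diagonal_mul_diagonal, ← Matrix.diagonal_one]
    congr 1
    funext i
    exact mul_inv_cancel₀ (hJ i).ne'
  rw [h]
  ext i
  fin_cases i <;> simp [eulerField, Matrix.mulVec_diagonal, cross_apply] <;> ring

/-- A fixed direction `a` seen in the body frame, together with the angular velocity `ω`. -/
structure IsBodySolution (J : Fin 3 → ℝ) (I : Set ℝ) (a ω : ℝ → Fin 3 → ℝ) : Prop where
  direction : ∀ t ∈ I, HasDerivWithinAt a (crossProduct (a t) (ω t)) I t
  euler : ∀ t ∈ I, HasDerivWithinAt ω (eulerField J (ω t)) I t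
  unit : ∀ t ∈ I, a t ⬝ᵥ a t = 1

theorem transpose_mul_self_of_mem {R : Matrix (Fin 3) (Fin 3) ℝ}
    (hR : R ∈ Matrix.specialOrthogonalGroup (Fin 3) ℝ) : Rᵀ * R = 1 ∧ R * Rᵀ = 1 := by
  have h := (Matrix.mem_specialOrthogonalGroup_iff.mp hR).1
  exact ⟨(Matrix.mem_orthogonalGroup_iff' _ _).mp h, (Matrix.mem_orthogonalGroup_iff _ _).mp h⟩

theorem IsSolution.isBodySolution {J : Fin 3 → ℝ} (hJ : ∀ i, 0 < J i) {I : Set ℝ}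
    {R : ℝ → Matrix (Fin 3) (Fin 3) ℝ} {ω : ℝ → Fin 3 → ℝ}
    (h : IsSolution J (fun _ => 0) I R ω) {a₀ : Fin 3 → ℝ} (ha₀ : a₀ ⬝ᵥ a₀ = 1) :
    IsBodySolution J I (fun t => (R t)ᵀ *ᵥ a₀) ω where
  direction t ht := by
    rw [hasDerivWithinAt_pi]
    intro i
    have h0 := h.attitude t ht 0 i
    have h1 := h.attitude t ht 1 i
    have h2 := h.attitude t ht 2 i
    have := ((h0.mul_const (a₀ 0)).add (h1.mul_const (a₀ 1))).add (h2.mul_const (a₀ 2))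
    refine (this.congr_deriv ?_).congr_of_mem ?_ ht
    · fin_cases i <;> simp [Matrix.mul_apply, Fin.sum_univ_three, skew, cross_apply, Matrix.mulVec,
        dotProduct] <;> ring
    · intro s _
      simp [Matrix.mulVec, dotProduct, Fin.sum_univ_three]
  euler t ht := by
    rw [← eulerField_eq J hJ]
    exact h.euler t ht
  unit t ht := by
    have := (transpose_mul_self_of_mem (h.rotation t ht)).2
    rw [Matrix.mulVec_transpose, ← Matrix.dotProduct_mulVec, ← Matrix.mulVec_transpose,
      Matrix.mulVec_mulVec, this, Matrix.one_mulVec, ha₀]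

theorem aligned_mulVec_iff {R : Matrix (Fin 3) (Fin 3) ℝ}
    (hR : R ∈ Matrix.specialOrthogonalGroup (Fin 3) ℝ) (v a₀ : Fin 3 → ℝ) :
    Aligned (R *ᵥ v) a₀ ↔ Aligned v (Rᵀ *ᵥ a₀) := by
  obtain ⟨h1, h2⟩ := transpose_mul_self_of_mem hR
  constructor
  · rintro ⟨c, hc⟩
    refine ⟨c, ?_⟩
    rw [← Matrix.mulVec_smul, ← hc, Matrix.mulVec_mulVec, h1, Matrix.one_mulVec]
  · rintro ⟨c, hc⟩
    refine ⟨c, ?_⟩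
    rw [hc, Matrix.mulVec_smul, Matrix.mulVec_mulVec, h2, Matrix.one_mulVec]

theorem eq_of_hasDerivWithinAt_zero {I : Set ℝ} (hI : IsUpperSet I) {f : ℝ → ℝ}
    (hf : ∀ t ∈ I, HasDerivWithinAt f 0 I t) {s t : ℝ} (hs : s ∈ I) (ht : t ∈ I) : f s = f t := by
  have := (hI.ordConnected.convex).norm_image_sub_le_of_norm_hasDerivWithin_le (C := 0)
    (f := f) (f' := fun _ => 0) hf (by simp) ht hs
  simpa [sub_eq_zero] using this

variable {J : Fin 3 → ℝ} {I : Set ℝ} {a ω : ℝ → Fin 3 → ℝ}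

namespace IsBodySolution

theorem direction_apply (h : IsBodySolution J I a ω) {t : ℝ} (ht : t ∈ I) (i : Fin 3) :
    HasDerivWithinAt (fun s => a s i) (crossProduct (a t) (ω t) i) I t :=
  hasDerivWithinAt_pi.mp (h.direction t ht) i

theorem euler_apply (h : IsBodySolution J I a ω) {t : ℝ} (ht : t ∈ I) (i : Fin 3) :
    HasDerivWithinAt (fun s => ω s i) (eulerField J (ω t) i) I t :=
  hasDerivWithinAt_pi.mp (h.euler t ht) i

theorem energy_eq (h : IsBodySolution J I a ω) (hJ : ∀ i, 0 < J i) (hI : IsUpperSet I) {s t : ℝ}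
    (hs : s ∈ I) (ht : t ∈ I) : ∑ i, J i * ω s i ^ 2 = ∑ i, J i * ω t i ^ 2 := by
  refine eq_of_hasDerivWithinAt_zero hI (f := fun s => ∑ i, J i * ω s i ^ 2) ?_ hs ht
  intro r hr
  have := HasDerivWithinAt.fun_sum (u := Finset.univ)
    fun i _ => ((h.euler_apply hr i).pow 2).const_mul (J i)
  refine this.congr_deriv ?_
  have := (hJ 0).ne'; have := (hJ 1).ne'; have := (hJ 2).ne'
  simp [Fin.sum_univ_three, eulerField]
  field_simp
  ring

theorem momentum_sq_eq (h : IsBodySolution J I a ω) (hJ : ∀ i, 0 < J i) (hI : IsUpperSet I)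
    {s t : ℝ} (hs : s ∈ I) (ht : t ∈ I) :
    ∑ i, (J i * ω s i) ^ 2 = ∑ i, (J i * ω t i) ^ 2 := by
  refine eq_of_hasDerivWithinAt_zero hI (f := fun s => ∑ i, (J i * ω s i) ^ 2) ?_ hs ht
  intro r hr
  have := HasDerivWithinAt.fun_sum (u := Finset.univ)
    fun i _ => (((h.euler_apply hr i).const_mul (J i)).pow 2)
  refine this.congr_deriv ?_
  have := (hJ 0).ne'; have := (hJ 1).ne'; have := (hJ 2).ne'
  simp [Fin.sum_univ_three, eulerField]
  field_simp
  ring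

theorem momentum_direction_eq (h : IsBodySolution J I a ω) (hJ : ∀ i, 0 < J i)
    (hI : IsUpperSet I) {s t : ℝ} (hs : s ∈ I) (ht : t ∈ I) :
    ∑ i, J i * ω s i * a s i = ∑ i, J i * ω t i * a t i := by
  refine eq_of_hasDerivWithinAt_zero hI (f := fun s => ∑ i, J i * ω s i * a s i) ?_ hs ht
  intro r hr
  have := HasDerivWithinAt.fun_sum (u := Finset.univ)
    fun i _ => (((h.euler_apply hr i).const_mul (J i)).mul (h.direction_apply hr i))
  refine this.congr_deriv ?_
  have := (hJ 0).ne'; have := (hJ 1).ne'; have := (hJ 2).ne'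
  simp [Fin.sum_univ_three, eulerField, cross_apply]
  field_simp
  ring

theorem sum_direction_sq (h : IsBodySolution J I a ω) {t : ℝ} (ht : t ∈ I) :
    ∑ i, a t i ^ 2 = 1 := by
  rw [← h.unit t ht]
  simp [dotProduct, sq]

/-- `|Jω - k a|²` expands into the three first integrals and `|a|² = 1`, so it is constant;
vanishing at `t` it vanishes at `s`, with no appeal to ODE uniqueness. -/
theorem momentum_eq_smul (h : IsBodySolution J I a ω) (hJ : ∀ i, 0 < J i) (hI : IsUpperSet I)
    {s t : ℝ} (hs : s ∈ I) (ht : t ∈ I) {k : ℝ} (hk : ∀ i, J i * ω t i = k * a t i) (i : Fin 3) :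
    J i * ω s i = k * a s i := by
  have h1 := h.momentum_sq_eq hJ hI hs ht
  have h2 := h.momentum_direction_eq hJ hI hs ht
  have h3 := h.sum_direction_sq hs
  have h4 := h.sum_direction_sq ht
  simp only [hk] at h1 h2
  simp only [Fin.sum_univ_three] at *
  have key : (J 0 * ω s 0 - k * a s 0) ^ 2 + (J 1 * ω s 1 - k * a s 1) ^ 2 +
      (J 2 * ω s 2 - k * a s 2) ^ 2 = 0 := by
    linear_combination h1 - 2 * k * h2 + k ^ 2 * h3 - k ^ 2 * h4
  have : (J i * ω s i - k * a s i) ^ 2 = 0 := by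
    have := sq_nonneg (J 0 * ω s 0 - k * a s 0)
    have := sq_nonneg (J 1 * ω s 1 - k * a s 1)
    have := sq_nonneg (J 2 * ω s 2 - k * a s 2)
    fin_cases i <;> simp only [Fin.zero_eta, Fin.mk_one, Fin.reduceFinMk] <;> linarith
  have := pow_eq_zero_iff (two_ne_zero) |>.mp this
  linarith

end IsBodySolution

open Filter Topology Set

/-! ### Persistent excitation as an integral inequality. -/

theorem dotProduct_matrixIntegral_mulVec {F : ℝ → Matrix (Fin 3) (Fin 3) ℝ} {s t : ℝ}
    (hF : ∀ i j, IntervalIntegrable (fun r => F r i j) volume s t) (x : Fin 3 → ℝ) :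
    x ⬝ᵥ (matrixIntegral F s t *ᵥ x) = ∫ r in s..t, x ⬝ᵥ (F r *ᵥ x) := by
  simp only [dotProduct, Matrix.mulVec, matrixIntegral, Matrix.of_apply]
  rw [intervalIntegral.integral_finsetSum]
  · refine Finset.sum_congr rfl fun i _ => ?_
    rw [intervalIntegral.integral_const_mul, intervalIntegral.integral_finsetSum]
    · congr 1
      refine Finset.sum_congr rfl fun j _ => ?_
      rw [intervalIntegral.integral_mul_const]
    · exact fun j _ => (hF i j).mul_const _
  · intro i _
    refine IntervalIntegrable.const_mul ?_ _
    exact IntervalIntegrable.sum (f := fun j r => F r i j * x j) Finset.univ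
      (fun j _ => (hF i j).mul_const _) |>.congr (by
        intro r _; simp [Finset.sum_apply])

theorem dotProduct_skew_transpose_mul_skew_mulVec (v x : Fin 3 → ℝ) :
    x ⬝ᵥ (((skew v)ᵀ * skew v) *ᵥ x) = ∑ i, crossProduct v x i ^ 2 := by
  rw [← Matrix.mulVec_mulVec, Matrix.mulVec_transpose, ← skew_mulVec]
  rw [dotProduct_comm, ← Matrix.dotProduct_mulVec]
  simp [dotProduct, sq]

theorem isSymm_matrixIntegral (v : ℝ → Fin 3 → ℝ) (s t : ℝ) :
    (matrixIntegral (fun r => (skew (v r))ᵀ * skew (v r)) s t).IsSymm := by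
  ext i j
  simp only [matrixIntegral, Matrix.transpose_apply, Matrix.of_apply]
  congr 1
  funext r
  have : ((skew (v r))ᵀ * skew (v r)).IsSymm := Matrix.isSymm_transpose_mul_self _
  exact this.apply i j

/-- The form of `[v]ᵀ[v]` at `x` is `|v × x|²`, and the symmetry that `PosSemidef` demands is
automatic. -/
theorem posSemidef_iff_integral {v : ℝ → Fin 3 → ℝ} {t T μ : ℝ} (hT : 0 < T)
    (hv : ContinuousOn v (Icc t (t + T))) :
    ((1 / T) • matrixIntegral (fun s => (skew (v s))ᵀ * skew (v s)) t (t + T)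
      - μ • (1 : Matrix (Fin 3) (Fin 3) ℝ)).PosSemidef ↔
    ∀ x : Fin 3 → ℝ, μ * ∑ i, x i ^ 2 ≤
      (1 / T) * ∫ s in t..(t + T), ∑ i, crossProduct (v s) x i ^ 2 := by
  have hint : ∀ i j, IntervalIntegrable (fun r => ((skew (v r))ᵀ * skew (v r)) i j) volume
      t (t + T) := by
    intro i j
    apply ContinuousOn.intervalIntegrable
    rw [uIcc_of_le (by linarith)]
    have hc : ∀ k, ContinuousOn (fun r => v r k) (Icc t (t + T)) := continuousOn_pi.mp hv
    have h0 := hc 0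
    have h1 := hc 1
    have h2 := hc 2
    fin_cases i <;> fin_cases j <;>
      simp only [Matrix.mul_apply, Fin.sum_univ_three, skew, Matrix.transpose_apply, Matrix.of_apply,
        Fin.zero_eta, Fin.mk_one, Fin.reduceFinMk, Matrix.cons_val] <;> fun_prop
  rw [Matrix.posSemidef_iff_dotProduct_mulVec]
  have hH : ((1 / T) • matrixIntegral (fun s => (skew (v s))ᵀ * skew (v s)) t (t + T)
      - μ • (1 : Matrix (Fin 3) (Fin 3) ℝ)).IsHermitian := by
    rw [Matrix.IsHermitian, Matrix.conjTranspose_eq_transpose_of_trivial]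
    simp only [Matrix.transpose_sub, Matrix.transpose_smul, Matrix.transpose_one]
    rw [isSymm_matrixIntegral v]
  simp only [hH, true_and]
  refine forall_congr' fun x => ?_
  simp only [star_trivial, Matrix.sub_mulVec, Matrix.smul_mulVec, Matrix.one_mulVec, dotProduct_sub,
    dotProduct_smul, dotProduct_matrixIntegral_mulVec hint,
    dotProduct_skew_transpose_mul_skew_mulVec, smul_eq_mul, sub_nonneg]
  simp [dotProduct, sq]

theorem sum_crossProduct_sq (v x : Fin 3 → ℝ) :
    ∑ i, crossProduct v x i ^ 2 = (∑ i, v i ^ 2) * (∑ i, x i ^ 2) - (∑ i, v i * x i) ^ 2 := by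
  simp [Fin.sum_univ_three, cross_apply]
  ring

theorem continuousOn_sum_crossProduct_sq {v : ℝ → Fin 3 → ℝ} {S : Set ℝ} (hv : ContinuousOn v S)
    (x : Fin 3 → ℝ) : ContinuousOn (fun s => ∑ i, crossProduct (v s) x i ^ 2) S := by
  have hc : ∀ k, ContinuousOn (fun r => v r k) S := continuousOn_pi.mp hv
  simp only [sum_crossProduct_sq]
  fun_prop

theorem Icc_subset_of_isUpperSet {I : Set ℝ} (hI : IsUpperSet I) {s t : ℝ} (hs : s ∈ I) :
    Icc s t ⊆ I := fun _ hr => hI hr.1 hs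

/-- A convergent direction is not persistently exciting. -/
theorem not_persistentlyExciting_of_tendsto {I : Set ℝ} (hI : IsUpperSet I) (hne : I.Nonempty)
    {a : ℝ → Fin 3 → ℝ} (ha : ContinuousOn a I) (hunit : ∀ t ∈ I, ∑ i, a t i ^ 2 = 1)
    {b : Fin 3 → ℝ} (hb : Tendsto a atTop (𝓝 b)) : ¬ PersistentlyExciting I a := by
  rintro ⟨T, μ, hT, hμ, -, h⟩
  obtain ⟨t₀, ht₀⟩ := hne
  have hIev : ∀ᶠ t in atTop, t ∈ I := by
    filter_upwards [eventually_ge_atTop t₀] with t ht using hI ht ht₀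
  have hcont : Continuous fun v : Fin 3 → ℝ => ∑ i, v i ^ 2 := by fun_prop
  have hb1 : ∑ i, b i ^ 2 = 1 := by
    refine tendsto_nhds_unique ((hcont.tendsto b).comp hb) ?_
    refine tendsto_const_nhds.congr' ?_
    filter_upwards [hIev] with t ht using (hunit t ht).symm
  have hcross : Tendsto (fun t => ∑ i, crossProduct (a t) b i ^ 2) atTop (𝓝 0) := by
    have hc : Continuous fun v : Fin 3 → ℝ => ∑ i, crossProduct v b i ^ 2 := by
      simp only [sum_crossProduct_sq]
      fun_prop
    have := (hc.tendsto b).comp hb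
    simpa [Function.comp_def] using this
  have hev : ∀ᶠ t in atTop, t ∈ I ∧ ∑ i, crossProduct (a t) b i ^ 2 ≤ μ / 2 :=
    hIev.and (hcross.eventually_le_const (by positivity))
  obtain ⟨t₁, ht₁⟩ := eventually_atTop.mp hev
  have hsub := Icc_subset_of_isUpperSet hI (t := t₁ + T) (ht₁ t₁ le_rfl).1
  have hca := ha.mono hsub
  -- Test against the limit direction itself: the lower bound is `μ`, while the integrand is at most
  -- `μ / 2` on the whole window.
  have := (posSemidef_iff_integral hT hca).mp (h t₁ (ht₁ t₁ le_rfl).1) b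
  have hle : ∫ s in t₁..(t₁ + T), ∑ i, crossProduct (a s) b i ^ 2 ≤
      ∫ _ in t₁..(t₁ + T), μ / 2 := by
    apply intervalIntegral.integral_mono_on (by linarith)
    · apply ContinuousOn.intervalIntegrable
      rw [uIcc_of_le (by linarith)]
      exact continuousOn_sum_crossProduct_sq hca b
    · simp
    · exact fun s hs => (ht₁ s hs.1).2
  rw [intervalIntegral.integral_const, smul_eq_mul, add_sub_cancel_left] at hle
  rw [hb1, mul_one] at this
  have h2 : 1 / T * ∫ s in t₁..(t₁ + T), ∑ i, crossProduct (a s) b i ^ 2 ≤ μ / 2 := by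
    calc _ ≤ 1 / T * (T * (μ / 2)) := by gcongr
      _ = μ / 2 := by field_simp
  linarith

/-- Without persistent excitation there are windows of length one in which the direction is
arbitrarily close in mean to a fixed line. -/
theorem exists_seq_of_not_persistentlyExciting {I : Set ℝ} (hI : IsUpperSet I)
    {a : ℝ → Fin 3 → ℝ} (ha : ContinuousOn a I) (h : ¬ PersistentlyExciting I a) :
    ∃ (t : ℕ → ℝ) (x : ℕ → Fin 3 → ℝ), (∀ n, t n ∈ I) ∧ (∀ n, ∑ i, x n i ^ 2 = 1) ∧
      ∀ n, ∫ s in (t n)..(t n + 1), ∑ i, crossProduct (a s) (x n) i ^ 2 ≤ 1 / ((n : ℝ) + 2) := by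
  have key : ∀ n : ℕ, ∃ (t : ℝ) (x : Fin 3 → ℝ), t ∈ I ∧ ∑ i, x i ^ 2 = 1 ∧
      ∫ s in t..(t + 1), ∑ i, crossProduct (a s) x i ^ 2 ≤ 1 / ((n : ℝ) + 2) := by
    intro n
    have hn : (0 : ℝ) ≤ n := n.cast_nonneg
    by_contra! hcon
    -- Failure with `T = 1` is enough; the shift by 2 keeps `μ < 1` already at `n = 0`.
    refine h ⟨1, 1 / ((n : ℝ) + 2), one_pos, by positivity, ?_, ?_⟩
    · rw [div_lt_one (by positivity)]
      linarith
    · intro t ht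
      rw [posSemidef_iff_integral one_pos (ha.mono (Icc_subset_of_isUpperSet hI ht))]
      intro x
      set N := ∑ i, x i ^ 2 with hN
      have hN0 : 0 ≤ N := Finset.sum_nonneg fun i _ => sq_nonneg _
      rcases hN0.eq_or_lt with h0 | hpos
      · rw [← h0, mul_zero]
        have : 0 ≤ ∫ s in t..(t + 1), ∑ i, crossProduct (a s) x i ^ 2 :=
          intervalIntegral.integral_nonneg (by linarith)
            fun s _ => Finset.sum_nonneg fun i _ => sq_nonneg _
        simpa using this
      · have hs : √N ^ 2 = N := Real.sq_sqrt hN0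
        have hs0 : 0 < √N := Real.sqrt_pos.mpr hpos
        have h1 := hcon t ((√N)⁻¹ • x) ht (by
          simp only [Pi.smul_apply, smul_eq_mul, mul_pow, ← Finset.mul_sum, ← hN, inv_pow, hs]
          exact inv_mul_cancel₀ hpos.ne')
        simp only [map_smul, Pi.smul_apply, smul_eq_mul, mul_pow, ← Finset.mul_sum, inv_pow, hs,
          intervalIntegral.integral_const_mul] at h1
        have h2 := mul_lt_mul_of_pos_left h1 hpos
        rw [mul_inv_cancel_left₀ hpos.ne'] at h2
        rw [div_one, one_mul, mul_comm]
        exact h2.le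
  choose t x h1 h2 h3 using key
  exact ⟨t, x, h1, h2, h3⟩

/-! ### Barbalat-type lemmas on windows. -/

/-- The functions `f n` tend to zero uniformly on the windows `[t n, t n + 1]`. -/
def SmallOnWindows (t : ℕ → ℝ) (f : ℕ → ℝ → ℝ) : Prop :=
  ∀ ε > 0, ∀ᶠ n in atTop, ∀ s ∈ Icc (t n) (t n + 1), |f n s| ≤ ε

/-- The functions `f n` are uniformly equicontinuous on the windows `[t n, t n + 1]`. -/
def EquicontinuousOnWindows (t : ℕ → ℝ) (f : ℕ → ℝ → ℝ) : Prop :=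
  ∀ ε > 0, ∃ δ > 0, ∀ n, ∀ s ∈ Icc (t n) (t n + 1), ∀ r ∈ Icc (t n) (t n + 1),
    |s - r| ≤ δ → |f n s - f n r| ≤ ε

/-- Start the subinterval at `s`, unless it would overrun the window; then slide it back to the
right end. -/
theorem exists_subwindow {t s h : ℝ} (hs : s ∈ Icc t (t + 1)) (h0 : 0 < h) (h1 : h ≤ 1) :
    ∃ u, t ≤ u ∧ u + h ≤ t + 1 ∧ s ∈ Icc u (u + h) := by
  obtain ⟨hs1, hs2⟩ := hs
  refine ⟨min s (t + 1 - h), le_min hs1 (by linarith), ?_, min_le_left _ _, ?_⟩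
  · have := min_le_right s (t + 1 - h)
    linarith
  · rcases min_choice s (t + 1 - h) with h | h <;> rw [h] <;> linarith

/-- On a subinterval of length `h` around `s` the mean value theorem yields a point where the
derivative is small, and equicontinuity carries the bound to `s`. -/
theorem SmallOnWindows.deriv {t : ℕ → ℝ} {f g : ℕ → ℝ → ℝ} (hf : SmallOnWindows t f)
    (hg : EquicontinuousOnWindows t g)
    (hfg : ∀ n, ∀ s ∈ Icc (t n) (t n + 1),
      HasDerivWithinAt (f n) (g n s) (Icc (t n) (t n + 1)) s) : SmallOnWindows t g := by
  intro ε hε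
  obtain ⟨δ, hδ, hgδ⟩ := hg (ε / 2) (by positivity)
  set h := min δ 1 with hh
  have h0 : 0 < h := lt_min hδ one_pos
  -- The slope over length `h` is then at most `2 (ε h / 4) / h = ε / 2`.
  filter_upwards [hf (ε * h / 4) (by positivity)] with n hn s hs
  obtain ⟨u, hu1, hu2, hsu⟩ := exists_subwindow hs h0 (min_le_right _ _)
  have hsub : Icc u (u + h) ⊆ Icc (t n) (t n + 1) := Icc_subset_Icc hu1 hu2
  obtain ⟨ξ, hξ, hslope⟩ := exists_hasDerivAt_eq_slope (f n) (g n) (a := u) (b := u + h)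
    (by linarith) (fun r hr => ((hfg n r (hsub hr)).continuousWithinAt).mono hsub)
    (fun r hr => (hfg n r (hsub (Ioo_subset_Icc_self hr))).hasDerivAt
      (mem_of_superset (Icc_mem_nhds hr.1 hr.2) hsub))
  have hξ' := Ioo_subset_Icc_self hξ
  have h1 : |g n ξ| ≤ ε / 2 := by
    rw [hslope, add_sub_cancel_left, abs_div, abs_of_pos h0, div_le_iff₀ h0]
    have e1 := hn (u + h) (hsub ⟨by linarith, le_rfl⟩)
    have e2 := hn u (hsub ⟨le_rfl, by linarith⟩)
    have := abs_sub (f n (u + h)) (f n u)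
    linarith
  have h2 : |g n s - g n ξ| ≤ ε / 2 := by
    refine hgδ n s hs ξ (hsub hξ') ?_
    refine le_trans ?_ (min_le_left δ 1)
    rw [← hh, abs_le]
    constructor <;> linarith [hsu.1, hsu.2, hξ'.1, hξ'.2]
  have h3 := abs_add_le (g n s - g n ξ) (g n ξ)
  rw [sub_add_cancel] at h3
  linarith

/-- A value above `ε` forces `|f n| ≥ ε / 2` on a subinterval of length `h`, so the integral is at
least `h (ε / 2)²`, impossible for large `n`. -/
theorem SmallOnWindows.of_integral_sq {t : ℕ → ℝ} {f : ℕ → ℝ → ℝ}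
    (hf : EquicontinuousOnWindows t f) (hc : ∀ n, ContinuousOn (f n) (Icc (t n) (t n + 1)))
    (hint : ∀ n : ℕ, ∫ s in (t n)..(t n + 1), f n s ^ 2 ≤ 1 / ((n : ℝ) + 2)) :
    SmallOnWindows t f := by
  intro ε hε
  obtain ⟨δ, hδ, hfδ⟩ := hf (ε / 2) (by positivity)
  set h := min δ 1 with hh
  have h0 : 0 < h := lt_min hδ one_pos
  have hlim : Tendsto (fun n : ℕ => 1 / ((n : ℝ) + 2)) atTop (𝓝 0) :=
    tendsto_const_nhds.div_atTop (tendsto_atTop_add_const_right _ _ tendsto_natCast_atTop_atTop)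
  have hpos : 0 < h * (ε / 2) ^ 2 := by positivity
  filter_upwards [hlim.eventually_lt_const hpos] with n hn s hs
  by_contra! hcon
  obtain ⟨u, hu1, hu2, hsu⟩ := exists_subwindow hs h0 (min_le_right _ _)
  have hsub : Icc u (u + h) ⊆ Icc (t n) (t n + 1) := Icc_subset_Icc hu1 hu2
  have hint1 : IntervalIntegrable (fun s => f n s ^ 2) volume (t n) (t n + 1) := by
    apply ContinuousOn.intervalIntegrable
    rw [uIcc_of_le (by linarith)]
    exact (hc n).pow 2
  have e1 : ∫ _ in u..(u + h), (ε / 2) ^ 2 ≤ ∫ r in u..(u + h), f n r ^ 2 := by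
    apply intervalIntegral.integral_mono_on (by linarith) (by simp)
    · apply ContinuousOn.intervalIntegrable
      rw [uIcc_of_le (by linarith)]
      exact ((hc n).mono hsub).pow 2
    · intro r hr
      have e := hfδ n s hs r (hsub hr) (by
        refine le_trans ?_ (min_le_left δ 1)
        rw [← hh, abs_le]
        constructor <;> linarith [hsu.1, hsu.2, hr.1, hr.2])
      have e' := abs_sub_abs_le_abs_sub (f n s) (f n r)
      rw [← sq_abs (f n r)]
      apply pow_le_pow_left₀ (by positivity)
      linarith
  have e2 : ∫ r in u..(u + h), f n r ^ 2 ≤ ∫ r in (t n)..(t n + 1), f n r ^ 2 :=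
    intervalIntegral.integral_mono_interval hu1 (by linarith) hu2
      (Eventually.of_forall fun r => sq_nonneg _) hint1
  rw [intervalIntegral.integral_const, smul_eq_mul, add_sub_cancel_left] at e1
  linarith [hint n]

/-- One compact set and one Lipschitz constant serve all `n`, so uniform continuity of `φ` on `K`
gives a modulus independent of `n`. -/
theorem EquicontinuousOnWindows.of_lipschitz {V : Type*} [PseudoMetricSpace V] {K : Set V}
    (hK : IsCompact K) {φ : V → ℝ} (hφ : Continuous φ) {t : ℕ → ℝ} {z : ℕ → ℝ → V} {M : ℝ}
    (hz : ∀ n, ∀ s ∈ Icc (t n) (t n + 1), z n s ∈ K)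
    (hM : ∀ n, ∀ s ∈ Icc (t n) (t n + 1), ∀ r ∈ Icc (t n) (t n + 1),
      dist (z n s) (z n r) ≤ M * |s - r|) :
    EquicontinuousOnWindows t fun n s => φ (z n s) := by
  intro ε hε
  have hu := hK.uniformContinuousOn_of_continuous hφ.continuousOn
  obtain ⟨δ, hδ, h⟩ := Metric.uniformContinuousOn_iff_le.mp hu ε hε
  refine ⟨δ / (|M| + 1), by positivity, fun n s hs r hr hsr => ?_⟩
  refine h _ (hz n s hs) _ (hz n r hr) ?_
  calc dist (z n s) (z n r) ≤ M * |s - r| := hM n s hs r hr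
    _ ≤ (|M| + 1) * |s - r| := by
      gcongr
      linarith [le_abs_self M]
    _ ≤ (|M| + 1) * (δ / (|M| + 1)) := by gcongr
    _ = δ := by field_simp

/-! ### Compactness: from failure of PE to a limit state. -/

theorem norm_le_one_of_sum_sq {x : Fin 3 → ℝ} (hx : ∑ i, x i ^ 2 = 1) : ‖x‖ ≤ 1 := by
  rw [pi_norm_le_iff_of_nonneg zero_le_one]
  intro i
  rw [Real.norm_eq_abs, ← sq_le_one_iff_abs_le_one, ← hx]
  exact Finset.single_le_sum (f := fun i => x i ^ 2) (fun j _ => sq_nonneg _) (Finset.mem_univ i)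

theorem continuous_crossProduct :
    Continuous fun z : (Fin 3 → ℝ) × (Fin 3 → ℝ) => crossProduct z.1 z.2 := by
  refine continuous_pi fun i => ?_
  fin_cases i <;> simp [cross_apply] <;> fun_prop

theorem continuous_eulerField (J : Fin 3 → ℝ) : Continuous (eulerField J) := by
  refine continuous_pi fun i => ?_
  fin_cases i <;> simp [eulerField] <;> fun_prop

namespace IsBodySolution

theorem continuousOn_direction (h : IsBodySolution J I a ω) : ContinuousOn a I :=
  fun t ht => (h.direction t ht).continuousWithinAt

/-- Conservation of energy bounds `ω`. Taking `1 ≤ r` lets the same ball hold the unit vectors as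
well. -/
theorem exists_norm_le (h : IsBodySolution J I a ω) (hJ : ∀ i, 0 < J i) (hI : IsUpperSet I)
    {t₀ : ℝ} (ht₀ : t₀ ∈ I) : ∃ r : ℝ, 1 ≤ r ∧ ∀ t ∈ I, ‖ω t‖ ≤ r := by
  set E := ∑ i, J i * ω t₀ i ^ 2 with hE
  have hE0 : 0 ≤ E := Finset.sum_nonneg fun i _ => mul_nonneg (hJ i).le (sq_nonneg _)
  have hs0 : ∀ i ∈ Finset.univ, 0 ≤ E / J i := fun i _ => div_nonneg hE0 (hJ i).le
  refine ⟨1 + ∑ i, E / J i, by linarith [Finset.sum_nonneg hs0], fun t ht => ?_⟩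
  rw [pi_norm_le_iff_of_nonneg (by linarith [Finset.sum_nonneg hs0])]
  intro i
  have h1 : J i * ω t i ^ 2 ≤ E := by
    rw [hE, h.energy_eq hJ hI ht₀ ht]
    exact Finset.single_le_sum (f := fun i => J i * ω t i ^ 2)
      (fun j _ => mul_nonneg (hJ j).le (sq_nonneg _)) (Finset.mem_univ i)
  have h2 : ω t i ^ 2 ≤ E / J i := by
    rw [le_div_iff₀ (hJ i)]
    linarith
  have h3 := Finset.single_le_sum hs0 (Finset.mem_univ i)
  rw [Real.norm_eq_abs]
  nlinarith [sq_nonneg (|ω t i| - 1), sq_abs (ω t i), abs_nonneg (ω t i)]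

theorem exists_lipschitz (h : IsBodySolution J I a ω) (hI : IsUpperSet I) {r : ℝ} (hr : 1 ≤ r)
    (hω : ∀ t ∈ I, ‖ω t‖ ≤ r) :
    ∃ M : ℝ, ∀ s ∈ I, ∀ t ∈ I, dist (a s, ω s) (a t, ω t) ≤ M * |s - t| := by
  have hc : Continuous fun z : (Fin 3 → ℝ) × (Fin 3 → ℝ) =>
      (crossProduct z.1 z.2, eulerField J z.2) :=
    continuous_crossProduct.prodMk ((continuous_eulerField J).comp continuous_snd)
  obtain ⟨M, hM⟩ := (isCompact_closedBall (0 : (Fin 3 → ℝ) × (Fin 3 → ℝ)) r).exists_bound_of_continuousOn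
    hc.continuousOn
  refine ⟨M, fun s hs t ht => ?_⟩
  rw [dist_eq_norm, ← Real.norm_eq_abs]
  refine (hI.ordConnected.convex).norm_image_sub_le_of_norm_hasDerivWithin_le
    (f := fun t => (a t, ω t))
    (fun t ht => (h.direction t ht).prodMk (h.euler t ht)) (fun t ht => ?_) ht hs
  refine hM (a t, ω t) ?_
  rw [mem_closedBall_zero_iff, Prod.norm_def]
  exact max_le ((norm_le_one_of_sum_sq (h.sum_direction_sq ht)).trans hr) (hω t ht)

/-- The test vector `x n` changes with the window, so it joins the state as a constant component in
the compact set. -/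
theorem equicontinuousOnWindows (h : IsBodySolution J I a ω) (hJ : ∀ i, 0 < J i)
    (hI : IsUpperSet I) {t : ℕ → ℝ} (ht : ∀ n, t n ∈ I) {x : ℕ → Fin 3 → ℝ}
    (hx : ∀ n, ∑ i, x n i ^ 2 = 1)
    {φ : ((Fin 3 → ℝ) × (Fin 3 → ℝ)) × (Fin 3 → ℝ) → ℝ} (hφ : Continuous φ) :
    EquicontinuousOnWindows t fun n s => φ ((a s, ω s), x n) := by
  obtain ⟨r, hr, hω⟩ := h.exists_norm_le hJ hI (ht 0)
  obtain ⟨M, hM⟩ := h.exists_lipschitz hI hr hω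
  refine EquicontinuousOnWindows.of_lipschitz (z := fun n s => ((a s, ω s), x n)) (M := M)
    (isCompact_closedBall 0 r) hφ ?_ ?_
  · intro n s hs
    have hsI := Icc_subset_of_isUpperSet hI (ht n) hs
    rw [mem_closedBall_zero_iff, Prod.norm_def, Prod.norm_def]
    exact max_le (max_le ((norm_le_one_of_sum_sq (h.sum_direction_sq hsI)).trans hr) (hω s hsI))
      ((norm_le_one_of_sum_sq (hx n)).trans hr)
  · intro n s hs u hu
    rw [Prod.dist_eq, dist_self, max_eq_left dist_nonneg]
    exact hM s (Icc_subset_of_isUpperSet hI (ht n) hs) u (Icc_subset_of_isUpperSet hI (ht n) hu)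

theorem hasDerivWithinAt_cross_const (h : IsBodySolution J I a ω) {t : ℝ} (ht : t ∈ I)
    (x : Fin 3 → ℝ) (i : Fin 3) :
    HasDerivWithinAt (fun s => crossProduct (a s) x i)
      (crossProduct (crossProduct (a t) (ω t)) x i) I t := by
  have h0 := h.direction_apply ht 0
  have h1 := h.direction_apply ht 1
  have h2 := h.direction_apply ht 2
  fin_cases i
  · simpa [cross_apply] using (h1.mul_const (x 2)).fun_sub (h2.mul_const (x 1))
  · simpa [cross_apply] using (h2.mul_const (x 0)).fun_sub (h0.mul_const (x 2))
  · simpa [cross_apply] using (h0.mul_const (x 1)).fun_sub (h1.mul_const (x 0))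

theorem hasDerivWithinAt_cross (h : IsBodySolution J I a ω) {t : ℝ} (ht : t ∈ I) (i : Fin 3) :
    HasDerivWithinAt (fun s => crossProduct (a s) (ω s) i)
      (crossProduct (crossProduct (a t) (ω t)) (ω t) i + crossProduct (a t) (eulerField J (ω t)) i)
      I t := by
  have h0 := h.direction_apply ht 0
  have h1 := h.direction_apply ht 1
  have h2 := h.direction_apply ht 2
  have k0 := h.euler_apply ht 0
  have k1 := h.euler_apply ht 1
  have k2 := h.euler_apply ht 2
  fin_cases i
  · refine ((h1.mul k2).sub (h2.mul k1)).congr_deriv ?_ |>.congr_of_mem ?_ ht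
    · simp [cross_apply]; ring
    · intro s _; simp [cross_apply]
  · refine ((h2.mul k0).sub (h0.mul k2)).congr_deriv ?_ |>.congr_of_mem ?_ ht
    · simp [cross_apply]; ring
    · intro s _; simp [cross_apply]
  · refine ((h0.mul k1).sub (h1.mul k0)).congr_deriv ?_ |>.congr_of_mem ?_ ht
    · simp [cross_apply]; ring
    · intro s _; simp [cross_apply]

theorem exists_windows_of_not_persistentlyExciting (h : IsBodySolution J I a ω)
    (hJ : ∀ i, 0 < J i) (hI : IsUpperSet I) (hPE : ¬ PersistentlyExciting I a) :
    ∃ t : ℕ → ℝ, (∀ n, t n ∈ I) ∧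
      (∀ i, SmallOnWindows t fun _ s => crossProduct (a s) (ω s) i) ∧
      (∀ i, SmallOnWindows t fun _ s => crossProduct (crossProduct (a s) (ω s)) (ω s) i +
        crossProduct (a s) (eulerField J (ω s)) i) := by
  obtain ⟨t, x, ht, hx, hint⟩ :=
    exists_seq_of_not_persistentlyExciting hI h.continuousOn_direction hPE
  have hsub : ∀ n, Icc (t n) (t n + 1) ⊆ I := fun n => Icc_subset_of_isUpperSet hI (ht n)
  have hcross := continuous_crossProduct
  have hw : ∀ i, SmallOnWindows t fun n s => crossProduct (a s) (x n) i := by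
    intro i
    have hc : ∀ n, ContinuousOn (fun s => crossProduct (a s) (x n) i) (Icc (t n) (t n + 1)) :=
      fun n s hs =>
        ((h.hasDerivWithinAt_cross_const (hsub n hs) (x n) i).mono (hsub n)).continuousWithinAt
    refine SmallOnWindows.of_integral_sq ?_ hc fun n => le_trans ?_ (hint n)
    · exact h.equicontinuousOnWindows hJ hI ht hx
        (φ := fun z => crossProduct z.1.1 z.2 i)
        ((continuous_apply i).comp (hcross.comp
          ((continuous_fst.comp continuous_fst).prodMk continuous_snd)))
    · apply intervalIntegral.integral_mono_on (by linarith)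
      · apply ContinuousOn.intervalIntegrable
        rw [uIcc_of_le (by linarith)]
        exact (hc n).pow 2
      · apply ContinuousOn.intervalIntegrable
        rw [uIcc_of_le (by linarith)]
        exact continuousOn_sum_crossProduct_sq (h.continuousOn_direction.mono (hsub n)) _
      · intro s _
        exact Finset.single_le_sum (f := fun i => crossProduct (a s) (x n) i ^ 2)
          (fun j _ => sq_nonneg _) (Finset.mem_univ i)
  have hw' : ∀ i, SmallOnWindows t fun n s =>
      crossProduct (crossProduct (a s) (ω s)) (x n) i := by
    intro i
    refine (hw i).deriv ?_ fun n s hs =>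
      (h.hasDerivWithinAt_cross_const (hsub n hs) (x n) i).mono (hsub n)
    exact h.equicontinuousOnWindows hJ hI ht hx
      (φ := fun z => crossProduct (crossProduct z.1.1 z.1.2) z.2 i)
      ((continuous_apply i).comp (hcross.comp
        ((hcross.comp continuous_fst).prodMk continuous_snd)))
  -- With `v = a × ω` and `x` a unit vector, `|v|² = |v × x|² + ⟨v, x⟩²`. The first term is small by
  -- `hw'`, the second because `⟨a × ω, x⟩ = -⟨a × x, ω⟩` and `a × x` is small.
  have hv : ∀ i, SmallOnWindows t fun _ s => crossProduct (a s) (ω s) i := by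
    obtain ⟨r, hr, hω⟩ := h.exists_norm_le hJ hI (ht 0)
    intro i ε hε
    -- The estimates below give `|a × ω|² ≤ 3η² + 9η²r² ≤ η² (3r + 2)²`.
    set η := ε / (3 * r + 2) with hη
    have hη0 : 0 < η := by positivity
    filter_upwards [eventually_all.mpr fun i => hw i η hη0,
      eventually_all.mpr fun i => hw' i η hη0] with n h1 h2 s hs
    have e1 : ∀ i, crossProduct (crossProduct (a s) (ω s)) (x n) i ^ 2 ≤ η ^ 2 := fun i =>
      sq_le_sq' (abs_le.mp (h2 i s hs)).1 (abs_le.mp (h2 i s hs)).2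
    have e2 : |∑ i, crossProduct (a s) (x n) i * ω s i| ≤ 3 * (η * r) := by
      refine (Finset.abs_sum_le_sum_abs _ _).trans ?_
      have : ∀ i ∈ Finset.univ, |crossProduct (a s) (x n) i * ω s i| ≤ η * r := by
        intro i _
        rw [abs_mul]
        exact mul_le_mul (h1 i s hs) ((norm_le_pi_norm (ω s) i).trans (hω s (hsub n hs)))
          (abs_nonneg _) hη0.le
      simpa using Finset.sum_le_card_nsmul _ _ _ this
    have e3 : ∑ i, crossProduct (a s) (ω s) i * x n i =
        -∑ i, crossProduct (a s) (x n) i * ω s i := by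
      simp [Fin.sum_univ_three, cross_apply]
      ring
    have e4 := sum_crossProduct_sq (crossProduct (a s) (ω s)) (x n)
    rw [hx n, mul_one, e3, neg_sq] at e4
    have e5 : (∑ i, crossProduct (a s) (x n) i * ω s i) ^ 2 ≤ (3 * (η * r)) ^ 2 :=
      sq_le_sq' (abs_le.mp e2).1 (abs_le.mp e2).2
    have e6 : ∑ i, crossProduct (crossProduct (a s) (ω s)) (x n) i ^ 2 ≤ 3 * η ^ 2 := by
      simpa using Finset.sum_le_card_nsmul _ _ _ fun i (_ : i ∈ Finset.univ) => e1 i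
    have e7 : crossProduct (a s) (ω s) i ^ 2 ≤ ∑ i, crossProduct (a s) (ω s) i ^ 2 :=
      Finset.single_le_sum (f := fun i => crossProduct (a s) (ω s) i ^ 2)
          (fun j _ => sq_nonneg _) (Finset.mem_univ i)
    have hεη : ε = η * (3 * r + 2) := by
      rw [hη]
      field_simp
    apply abs_le_of_sq_le_sq _ hε.le
    rw [hεη]
    nlinarith [sq_nonneg η, mul_nonneg (sq_nonneg η) (by linarith : (0 : ℝ) ≤ r)]
  refine ⟨t, ht, hv, fun i => ?_⟩
  refine (hv i).deriv ?_ fun n s hs => (h.hasDerivWithinAt_cross (hsub n hs) i).mono (hsub n)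
  refine h.equicontinuousOnWindows hJ hI ht hx
      (φ := fun z => crossProduct (crossProduct z.1.1 z.1.2) z.1.2 i +
        crossProduct z.1.1 (eulerField J z.1.2) i) ?_
  refine ((continuous_apply i).comp (hcross.comp ((hcross.comp continuous_fst).prodMk
    (continuous_snd.comp continuous_fst)))).add ?_
  exact (continuous_apply i).comp (hcross.comp ((continuous_fst.comp continuous_fst).prodMk
    ((continuous_eulerField J).comp (continuous_snd.comp continuous_fst))))

/-- Without persistent excitation some limit state has a stationary direction to second order. -/
theorem exists_limit_state (h : IsBodySolution J I a ω)
    (hJ : ∀ i, 0 < J i) (hI : IsUpperSet I) {t₀ : ℝ} (ht₀ : t₀ ∈ I)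
    (hPE : ¬ PersistentlyExciting I a) :
    ∃ b w : Fin 3 → ℝ, ∑ i, b i ^ 2 = 1 ∧ crossProduct b w = 0 ∧
      crossProduct b (eulerField J w) = 0 ∧
      ∑ i, J i * w i ^ 2 = ∑ i, J i * ω t₀ i ^ 2 ∧
      ∑ i, (J i * w i) ^ 2 = ∑ i, (J i * ω t₀ i) ^ 2 ∧
      ∑ i, J i * w i * b i = ∑ i, J i * ω t₀ i * a t₀ i := by
  obtain ⟨t, ht, h1, h2⟩ := h.exists_windows_of_not_persistentlyExciting hJ hI hPE
  obtain ⟨r, hr, hω⟩ := h.exists_norm_le hJ hI ht₀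
  obtain ⟨⟨b, w⟩, -, ψ, hψ, hlim⟩ :=
    (isCompact_closedBall (0 : (Fin 3 → ℝ) × (Fin 3 → ℝ)) r).tendsto_subseq
    (x := fun n => (a (t n), ω (t n))) (fun n => by
      rw [mem_closedBall_zero_iff, Prod.norm_def]
      exact max_le ((norm_le_one_of_sum_sq (h.sum_direction_sq (ht n))).trans hr) (hω _ (ht n)))
  have hcross := continuous_crossProduct
  have const : ∀ (φ : (Fin 3 → ℝ) × (Fin 3 → ℝ) → ℝ) (c : ℝ), Continuous φ →
      (∀ s ∈ I, φ (a s, ω s) = c) → φ (b, w) = c := by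
    intro φ c hφ hc
    refine tendsto_nhds_unique ((hφ.tendsto _).comp hlim) ?_
    refine tendsto_const_nhds.congr fun n => (hc _ (ht _)).symm
  have zero : ∀ φ : (Fin 3 → ℝ) × (Fin 3 → ℝ) → ℝ, Continuous φ →
      (SmallOnWindows t fun _ s => φ (a s, ω s)) → φ (b, w) = 0 := by
    intro φ hφ hs
    have h0 : Tendsto (fun n => φ (a (t n), ω (t n))) atTop (𝓝 0) := by
      rw [Metric.tendsto_atTop']
      intro ε hε
      obtain ⟨N, hN⟩ := eventually_atTop.mp (hs (ε / 2) (by positivity))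
      refine ⟨N, fun n hn => ?_⟩
      have := hN n hn.le (t n) ⟨le_rfl, by linarith⟩
      rw [Real.dist_eq, sub_zero]
      linarith
    exact tendsto_nhds_unique ((hφ.tendsto _).comp hlim) (h0.comp hψ.tendsto_atTop)
  have hbw : crossProduct b w = 0 := by
    funext i
    exact zero (fun z => crossProduct z.1 z.2 i) ((continuous_apply i).comp hcross) (h1 i)
  refine ⟨b, w, ?_, hbw, ?_, ?_, ?_, ?_⟩
  · exact const (fun z => ∑ i, z.1 i ^ 2) 1 (by fun_prop) fun s hs => h.sum_direction_sq hs
  · funext i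
    have := zero (fun z => crossProduct (crossProduct z.1 z.2) z.2 i +
      crossProduct z.1 (eulerField J z.2) i) ?_ (h2 i)
    -- Since `b × w = 0`, only the Euler-field term of the derivative survives in the limit.
    · simpa [hbw] using this
    · refine ((continuous_apply i).comp (hcross.comp (hcross.prodMk continuous_snd))).add ?_
      exact (continuous_apply i).comp (hcross.comp (continuous_fst.prodMk
        ((continuous_eulerField J).comp continuous_snd)))
  · exact const (fun z => ∑ i, J i * z.2 i ^ 2) _ (by fun_prop) fun s hs =>
      h.energy_eq hJ hI hs ht₀
  · exact const (fun z => ∑ i, (J i * z.2 i) ^ 2) _ (by fun_prop) fun s hs =>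
      h.momentum_sq_eq hJ hI hs ht₀
  · exact const (fun z => ∑ i, J i * z.2 i * z.1 i) _ (by fun_prop) fun s hs =>
      h.momentum_direction_eq hJ hI hs ht₀

end IsBodySolution
-- Algebra of stationary states and of the critical level sets.
theorem eq_smul_of_crossProduct_eq_zero {b v : Fin 3 → ℝ} (hb : ∑ i, b i ^ 2 = 1)
    (h : crossProduct b v = 0) (i : Fin 3) : v i = (∑ j, b j * v j) * b i := by
  have h0 := congrFun h 0
  have h1 := congrFun h 1
  have h2 := congrFun h 2
  simp only [cross_apply, Matrix.cons_val, Pi.zero_apply] at h0 h1 h2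
  simp only [Fin.sum_univ_three] at *
  fin_cases i <;> simp only [Fin.zero_eta, Fin.mk_one, Fin.reduceFinMk]
  · linear_combination -v 0 * hb - b 1 * h2 + b 2 * h1
  · linear_combination -v 1 * hb - b 2 * h0 + b 0 * h2
  · linear_combination -v 2 * hb - b 0 * h1 + b 1 * h0

/-- Write `w = l b` and the field at `w` as `m b`. Pairing `J` times the field with `b` kills `Jw ×
w` and leaves `m ⟨b, Jb⟩ = 0`, so `m = 0`: `w` is an equilibrium, and all `(Jᵢ - Jⱼ) bᵢ bⱼ` vanish
if `l ≠ 0`. -/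
theorem eigenvector_of_stationary (hJ : ∀ i, 0 < J i) {b w : Fin 3 → ℝ} (hb : ∑ i, b i ^ 2 = 1)
    (h : crossProduct b w = 0) (h' : crossProduct b (eulerField J w) = 0) :
    ∃ i₀, (∀ i, J i * w i = J i₀ * w i) ∧ ∃ k, ∀ i, J i * w i = k * b i := by
  have hw := eq_smul_of_crossProduct_eq_zero hb h
  have hF := eq_smul_of_crossProduct_eq_zero hb h'
  set l := ∑ j, b j * w j
  set m := ∑ j, b j * eulerField J w j
  have j0 := hJ 0
  have j1 := hJ 1
  have j2 := hJ 2
  have f0 : (J 1 - J 2) * l ^ 2 * b 1 * b 2 = J 0 * m * b 0 := by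
    have := hF 0
    simp only [eulerField, Matrix.cons_val, hw 1, hw 2] at this
    field_simp at this
    linear_combination this
  have f1 : (J 2 - J 0) * l ^ 2 * b 2 * b 0 = J 1 * m * b 1 := by
    have := hF 1
    simp only [eulerField, Matrix.cons_val, hw 2, hw 0] at this
    field_simp at this
    linear_combination this
  have f2 : (J 0 - J 1) * l ^ 2 * b 0 * b 1 = J 2 * m * b 2 := by
    have := hF 2
    simp only [eulerField, Matrix.cons_val, hw 0, hw 1] at this
    field_simp at this
    linear_combination this
  have hpos : 0 < J 0 * b 0 ^ 2 + J 1 * b 1 ^ 2 + J 2 * b 2 ^ 2 := by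
    by_contra! hle
    have e0 : J 0 * b 0 ^ 2 = 0 := by nlinarith [mul_nonneg j0.le (sq_nonneg (b 0)), mul_nonneg j1.le (sq_nonneg (b 1)), mul_nonneg j2.le (sq_nonneg (b 2))]
    have e1 : J 1 * b 1 ^ 2 = 0 := by nlinarith [mul_nonneg j0.le (sq_nonneg (b 0)), mul_nonneg j1.le (sq_nonneg (b 1)), mul_nonneg j2.le (sq_nonneg (b 2))]
    have e2 : J 2 * b 2 ^ 2 = 0 := by nlinarith [mul_nonneg j0.le (sq_nonneg (b 0)), mul_nonneg j1.le (sq_nonneg (b 1)), mul_nonneg j2.le (sq_nonneg (b 2))]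
    simp only [mul_eq_zero, j0.ne', j1.ne', j2.ne', false_or] at e0 e1 e2
    rw [Fin.sum_univ_three, e0, e1, e2] at hb
    norm_num at hb
  have hm : m = 0 := by
    have : m * (J 0 * b 0 ^ 2 + J 1 * b 1 ^ 2 + J 2 * b 2 ^ 2) = 0 := by
      linear_combination -b 0 * f0 - b 1 * f1 - b 2 * f2
    exact (mul_eq_zero.mp this).resolve_right hpos.ne'
  rw [hm] at f0 f1 f2
  by_cases hl : l = 0
  · simp only [hl, zero_mul] at hw
    exact ⟨0, by simp [hw], 0, by simp [hw]⟩
  have g : ∀ i j, (J i - J j) * b i * b j = 0 := by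
    have hl2 : l ^ 2 ≠ 0 := pow_ne_zero 2 hl
    have g0 : (J 1 - J 2) * b 1 * b 2 = 0 := mul_left_cancel₀ hl2 (by linear_combination f0)
    have g1 : (J 2 - J 0) * b 2 * b 0 = 0 := mul_left_cancel₀ hl2 (by linear_combination f1)
    have g2 : (J 0 - J 1) * b 0 * b 1 = 0 := mul_left_cancel₀ hl2 (by linear_combination f2)
    intro i j
    fin_cases i <;> fin_cases j <;> simp only [Fin.zero_eta, Fin.mk_one, Fin.reduceFinMk] <;>
      linarith
  obtain ⟨i₀, hi₀⟩ : ∃ i, b i ≠ 0 := by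
    by_contra! hcon
    simp [hcon] at hb
  have g' : ∀ i, J i * b i = J i₀ * b i := by
    intro i
    have := (mul_eq_zero.mp (g i i₀)).resolve_right hi₀
    linarith
  refine ⟨i₀, fun i => ?_, J i₀ * l, fun i => ?_⟩
  · rw [hw i]
    linear_combination l * g' i
  · rw [hw i]
    linear_combination l * g' i

theorem inEigenspace_iff {w : Fin 3 → ℝ} :
    InEigenspace J w ↔ ∃ c, ∀ i, J i * w i = c * w i := by
  simp [InEigenspace, funext_iff, Matrix.mulVec_diagonal]

theorem aligned_iff {v b : Fin 3 → ℝ} : Aligned v b ↔ ∃ k, ∀ i, v i = k * b i := by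
  simp [Aligned, funext_iff]

/-- On the level set `c (w ⬝ J w) = |J w|²` of an extremal moment of inertia `c` there are only
eigenvectors. -/
theorem mul_eq_mul_of_extremal (hJ : ∀ i, 0 < J i) {w : Fin 3 → ℝ} {c : ℝ}
    (hc : (∀ i, J i ≤ c) ∨ ∀ i, c ≤ J i) (hQ : ∑ i, J i * (c - J i) * w i ^ 2 = 0) (i : Fin 3) :
    J i * w i = c * w i := by
  have key : J i * (c - J i) * w i ^ 2 = 0 := by
    rcases hc with hc | hc
    · refine (Finset.sum_eq_zero_iff_of_nonneg fun j _ => ?_).mp hQ i (Finset.mem_univ i)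
      exact mul_nonneg (mul_nonneg (hJ j).le (by linarith [hc j])) (sq_nonneg _)
    · refine (Finset.sum_eq_zero_iff_of_nonpos fun j _ => ?_).mp hQ i (Finset.mem_univ i)
      exact mul_nonpos_of_nonpos_of_nonneg
        (mul_nonpos_of_nonneg_of_nonpos (hJ j).le (by linarith [hc j])) (sq_nonneg _)
  rcases mul_eq_zero.mp key with h | h
  · rcases mul_eq_zero.mp h with h | h
    · exact absurd h (hJ i).ne'
    · rw [sub_eq_zero.mp h]
  · rw [pow_eq_zero_iff two_ne_zero] at h
    simp [h]

theorem sum_perm (σ : Equiv.Perm (Fin 3)) (f : Fin 3 → ℝ) :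
    ∑ i, f i = f (σ 0) + f (σ 1) + f (σ 2) := by
  rw [← Equiv.sum_comp σ f, Fin.sum_univ_three]

/-- Square both sides; the middle coordinate drops out of the form because its coefficient is zero.
This makes the singular set a level set of first integrals. -/
theorem abs_eq_sqrt_mul_iff (σ : Equiv.Perm (Fin 3)) (hJ : ∀ i, 0 < J i)
    (h01 : J (σ 0) > J (σ 1)) (h12 : J (σ 1) > J (σ 2)) (w : Fin 3 → ℝ) :
    |w (σ 0)| = √(J (σ 2) * (J (σ 1) - J (σ 2)) / (J (σ 0) * (J (σ 0) - J (σ 1)))) * |w (σ 2)| ↔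
      ∑ i, J i * (J (σ 1) - J i) * w i ^ 2 = 0 := by
  have d01 := sub_pos.mpr h01
  have d12 := sub_pos.mpr h12
  have j0 := hJ (σ 0)
  have j2 := hJ (σ 2)
  rw [← sq_eq_sq₀ (abs_nonneg _) (by positivity), mul_pow, sq_abs, sq_abs,
    Real.sq_sqrt (by positivity), sum_perm σ]
  field_simp
  constructor <;> intro h <;> linear_combination -h

theorem exists_perm_of_not_extremal {i₀ : Fin 3} (h : ¬((∀ i, J i ≤ J i₀) ∨ ∀ i, J i₀ ≤ J i)) :
    ∃ σ : Equiv.Perm (Fin 3), σ 1 = i₀ ∧ J (σ 0) > J (σ 1) ∧ J (σ 1) > J (σ 2) := by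
  push Not at h
  obtain ⟨⟨p, hp⟩, q, hq⟩ := h
  have hpi : p ≠ i₀ := by rintro rfl; exact lt_irrefl _ hp
  have hqi : q ≠ i₀ := by rintro rfl; exact lt_irrefl _ hq
  have hpq : p ≠ q := by rintro rfl; linarith
  have hinj : Function.Injective ![p, i₀, q] := by
    intro i j hij
    fin_cases i <;> fin_cases j <;> simp_all
  refine ⟨Equiv.ofBijective _ (Finite.injective_iff_bijective.mp hinj), rfl, hp, hq⟩

theorem inEigenspace_or_onSingularSet (hJ : ∀ i, 0 < J i) {w : Fin 3 → ℝ} {i₀ : Fin 3}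
    (hQ : ∑ i, J i * (J i₀ - J i) * w i ^ 2 = 0) : InEigenspace J w ∨ OnSingularSet J w := by
  by_cases h : (∀ i, J i ≤ J i₀) ∨ ∀ i, J i₀ ≤ J i
  · exact Or.inl (inEigenspace_iff.mpr ⟨J i₀, mul_eq_mul_of_extremal hJ h hQ⟩)
  · obtain ⟨σ, rfl, h01, h12⟩ := exists_perm_of_not_extremal h
    exact Or.inr ⟨σ, h01, h12, (abs_eq_sqrt_mul_iff σ hJ h01 h12 w).mpr hQ⟩

theorem sum_level_eq (c : ℝ) (w : Fin 3 → ℝ) :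
    ∑ i, J i * (c - J i) * w i ^ 2 = c * ∑ i, J i * w i ^ 2 - ∑ i, (J i * w i) ^ 2 := by
  rw [Finset.mul_sum, ← Finset.sum_sub_distrib]
  exact Finset.sum_congr rfl fun i _ => by ring

namespace IsBodySolution

theorem level_eq (h : IsBodySolution J I a ω) (hJ : ∀ i, 0 < J i) (hI : IsUpperSet I) {s t : ℝ}
    (hs : s ∈ I) (ht : t ∈ I) (c : ℝ) :
    ∑ i, J i * (c - J i) * ω s i ^ 2 = ∑ i, J i * (c - J i) * ω t i ^ 2 := by
  rw [sum_level_eq, sum_level_eq, h.energy_eq hJ hI hs ht, h.momentum_sq_eq hJ hI hs ht]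

theorem of_not_persistentlyExciting (h : IsBodySolution J I a ω) (hJ : ∀ i, 0 < J i)
    (hI : IsUpperSet I) {t₀ : ℝ} (ht₀ : t₀ ∈ I) (hPE : ¬ PersistentlyExciting I a) :
    (InEigenspace J (ω t₀) ∨ OnSingularSet J (ω t₀)) ∧
      ∃ k, ∀ i, J i * ω t₀ i = k * a t₀ i := by
  obtain ⟨b, w, hb, h1, h2, hE, hL, hA⟩ := h.exists_limit_state hJ hI ht₀ hPE
  obtain ⟨i₀, hi₀, k, hk⟩ := eigenvector_of_stationary hJ hb h1 h2
  constructor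
  · apply inEigenspace_or_onSingularSet hJ (i₀ := i₀)
    rw [sum_level_eq, ← hE, ← hL, ← sum_level_eq]
    refine Finset.sum_eq_zero fun i _ => ?_
    linear_combination -J i * w i * hi₀ i
  · refine ⟨k, fun i => ?_⟩
    -- Equality case of Cauchy–Schwarz: `|Jω|² = k²`, `⟨Jω, a⟩ = k` and `|a| = 1` give `|Jω - k a|²
    -- = 0`.
    have e1 : ∑ i, (J i * ω t₀ i) ^ 2 = k ^ 2 := by
      rw [← hL]
      simp only [hk, mul_pow, ← Finset.mul_sum, hb, mul_one]
    have e2 : ∑ i, J i * ω t₀ i * a t₀ i = k := by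
      rw [← hA]
      simp only [hk, mul_assoc, ← sq, ← Finset.mul_sum, hb, mul_one]
    have e3 : ∑ i, (J i * ω t₀ i - k * a t₀ i) ^ 2 = 0 := by
      have e4 := h.sum_direction_sq ht₀
      simp only [Fin.sum_univ_three] at *
      linear_combination e1 - 2 * k * e2 + k ^ 2 * e4
    have := (Finset.sum_eq_zero_iff_of_nonneg fun j _ => sq_nonneg _).mp e3 i (Finset.mem_univ i)
    exact sub_eq_zero.mp (pow_eq_zero_iff two_ne_zero |>.mp this)

end IsBodySolution
-- Asymptotics on the separatrices.
-- Relabelling the axes changes the cross product only by the sign `s` of the permutation, so the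
-- separatrix can be studied with ordered moments.
theorem eulerField_perm (hJ : ∀ i, 0 < J i) (σ : Equiv.Perm (Fin 3)) :
    ∃ s : ℝ, s ^ 2 = 1 ∧ ∀ w,
      eulerField J w (σ 0) = s * (J (σ 1) - J (σ 2)) * w (σ 1) * w (σ 2) / J (σ 0) ∧
      eulerField J w (σ 1) = s * (J (σ 2) - J (σ 0)) * w (σ 2) * w (σ 0) / J (σ 1) ∧
      eulerField J w (σ 2) = s * (J (σ 0) - J (σ 1)) * w (σ 0) * w (σ 1) / J (σ 2) := by
  have h01 : σ 0 ≠ σ 1 := σ.injective.ne (by decide)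
  have h12 : σ 1 ≠ σ 2 := σ.injective.ne (by decide)
  have h02 : σ 0 ≠ σ 2 := σ.injective.ne (by decide)
  have j0 := (hJ 0).ne'
  have j1 := (hJ 1).ne'
  have j2 := (hJ 2).ne'
  revert h01 h12 h02
  generalize σ 0 = i
  generalize σ 1 = j
  generalize σ 2 = k
  intro h01 h12 h02
  have hcases : (j = i + 1 ∧ k = i + 2) ∨ (j = i + 2 ∧ k = i + 1) := by
    revert i j k
    decide
  rcases hcases with ⟨rfl, rfl⟩ | ⟨rfl, rfl⟩
  · refine ⟨1, by norm_num, fun w => ?_⟩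
    fin_cases i <;> refine ⟨?_, ?_, ?_⟩ <;> simp [eulerField]
  · refine ⟨-1, by norm_num, fun w => ?_⟩
    fin_cases i <;> refine ⟨?_, ?_, ?_⟩ <;> simp [eulerField] <;> ring

theorem tendsto_of_eqOn_const {E : Type*} [TopologicalSpace E] {f : ℝ → E} {t₀ : ℝ} {c : E}
    (h : ∀ t, t₀ ≤ t → f t = c) : Tendsto f atTop (𝓝 c) := by
  refine tendsto_const_nhds.congr' ?_
  filter_upwards [eventually_ge_atTop t₀] with t ht using (h t ht).symm

/-- If a function and its derivative both converge, the derivative tends to zero. -/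
theorem eq_zero_of_tendsto_of_hasDerivWithinAt {f f' : ℝ → ℝ} {t₀ l d : ℝ}
    (hf : ∀ t ∈ Ici t₀, HasDerivWithinAt f (f' t) (Ici t₀) t) (hl : Tendsto f atTop (𝓝 l))
    (hd : Tendsto f' atTop (𝓝 d)) : d = 0 := by
  have hmvt : ∀ t : ℝ, ∃ ξ, t₀ ≤ t → t ≤ ξ ∧ f' ξ = f (t + 1) - f t := by
    intro t
    by_cases ht : t₀ ≤ t
    · have hsub : Icc t (t + 1) ⊆ Ici t₀ := fun r hr => ht.trans hr.1
      obtain ⟨ξ, hξ, e⟩ := exists_hasDerivAt_eq_slope f f' (a := t) (b := t + 1) (by linarith)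
        (fun r hr => ((hf r (hsub hr)).continuousWithinAt).mono hsub)
        (fun r hr => (hf r (hsub (Ioo_subset_Icc_self hr))).hasDerivAt
          (mem_of_superset (Icc_mem_nhds hr.1 hr.2) hsub))
      refine ⟨ξ, fun _ => ⟨hξ.1.le, ?_⟩⟩
      rw [e, add_sub_cancel_left, div_one]
    · exact ⟨0, fun h => absurd h ht⟩
  choose ξ hξ using hmvt
  have hev : ∀ᶠ t in atTop, t ≤ ξ t ∧ f' (ξ t) = f (t + 1) - f t := by
    filter_upwards [eventually_ge_atTop t₀] with t ht using hξ t ht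
  have hξlim : Tendsto ξ atTop atTop := tendsto_atTop_mono' _ (hev.mono fun _ h => h.1) tendsto_id
  have h1 : Tendsto (fun t => f' (ξ t)) atTop (𝓝 d) := hd.comp hξlim
  have h2 : Tendsto (fun t => f' (ξ t)) atTop (𝓝 (l - l)) := by
    refine ((hl.comp (tendsto_atTop_add_const_right _ 1 tendsto_id)).sub hl).congr' ?_
    filter_upwards [hev] with t ht using ht.2.symm
  rw [sub_self] at h2
  exact tendsto_nhds_unique h1 h2

theorem exists_tendsto_of_deriv_nonneg {f f' : ℝ → ℝ} {t₀ C : ℝ}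
    (hf : ∀ t ∈ Ici t₀, HasDerivWithinAt f (f' t) (Ici t₀) t) (h0 : ∀ t ∈ Ici t₀, 0 ≤ f' t)
    (hC : ∀ t ∈ Ici t₀, f t ≤ C) : ∃ l, Tendsto f atTop (𝓝 l) := by
  have hmono : MonotoneOn f (Ici t₀) :=
    monotoneOn_of_hasDerivWithinAt_nonneg (convex_Ici t₀)
      (fun t ht => (hf t ht).continuousWithinAt)
      (fun t ht => (hf t (interior_subset ht)).mono interior_subset)
      (fun t ht => h0 t (interior_subset ht))
  -- Freezing `f` before `t₀` makes it monotone on all of `ℝ`.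
  have hm : Monotone fun t => f (max t t₀) := fun s t hst =>
    hmono (mem_Ici.mpr (le_max_right _ _)) (mem_Ici.mpr (le_max_right _ _)) (max_le_max_right _ hst)
  refine ⟨⨆ t, f (max t t₀), ?_⟩
  refine (tendsto_atTop_ciSup hm ⟨C, ?_⟩).congr' ?_
  · rintro _ ⟨t, rfl⟩
    exact hC _ (mem_Ici.mpr (le_max_right _ _))
  · filter_upwards [eventually_ge_atTop t₀] with t ht
    rw [max_eq_left ht]

/-- A solution of the Euler equations on a separatrix: it tends to a rotation about the middle
axis. -/
theorem tendsto_of_separatrix {A B C E s t₀ : ℝ} (hC : 0 < C) (hCB : C < B) (hBA : B < A)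
    (hs : s ^ 2 = 1) {x y z : ℝ → ℝ}
    (hx : ∀ t ∈ Ici t₀, HasDerivWithinAt x (s * (B - C) * y t * z t / A) (Ici t₀) t)
    (hy : ∀ t ∈ Ici t₀, HasDerivWithinAt y (s * (C - A) * z t * x t / B) (Ici t₀) t)
    (hz : ∀ t ∈ Ici t₀, HasDerivWithinAt z (s * (A - B) * x t * y t / C) (Ici t₀) t)
    (hE : ∀ t ∈ Ici t₀, A * x t ^ 2 + B * y t ^ 2 + C * z t ^ 2 = E)
    (hQ : ∀ t ∈ Ici t₀, A * (A - B) * x t ^ 2 = C * (B - C) * z t ^ 2) :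
    ∃ l, Tendsto x atTop (𝓝 0) ∧ Tendsto y atTop (𝓝 l) ∧ Tendsto z atTop (𝓝 0) := by
  have hB : 0 < B := hC.trans hCB
  have hA : 0 < A := hB.trans hBA
  have dAB : 0 < A - B := sub_pos.mpr hBA
  have dBC : 0 < B - C := sub_pos.mpr hCB
  have dAC : 0 < A - C := by linarith
  -- On the separatrix `|x| = κ |z|`, hence `|z x| = κ z²`.
  set κ := √(C * (B - C) / (A * (A - B))) with hκ
  have hκ0 : 0 < κ := by positivity
  have hκ2 : A * (A - B) * κ ^ 2 = C * (B - C) := by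
    rw [hκ, Real.sq_sqrt (by positivity)]
    field_simp
  have hxz : ∀ t ∈ Ici t₀, x t ^ 2 = κ ^ 2 * z t ^ 2 := by
    intro t ht
    have : A * (A - B) ≠ 0 := by positivity
    apply mul_left_cancel₀ this
    rw [hQ t ht, ← hκ2]
    ring
  have habs : ∀ t ∈ Ici t₀, |z t * x t| = κ * z t ^ 2 := by
    intro t ht
    rw [← sq_eq_sq₀ (abs_nonneg _) (by positivity), sq_abs, mul_pow, hxz t ht]
    ring
  have hzsq : ∀ t ∈ Ici t₀, z t ^ 2 = (E - B * y t ^ 2) / (A * κ ^ 2 + C) := by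
    intro t ht
    rw [eq_div_iff (by positivity), ← hE t ht, hxz t ht]
    ring
  have hEB : ∀ t ∈ Ici t₀, |y t| ≤ 1 + E / B := by
    intro t ht
    have : y t ^ 2 ≤ E / B := by
      rw [le_div_iff₀ hB]
      nlinarith [hE t ht, mul_nonneg hA.le (sq_nonneg (x t)), mul_nonneg hC.le (sq_nonneg (z t))]
    nlinarith [sq_abs (y t), sq_nonneg (|y t| - 1), abs_nonneg (y t)]
  have hcz : ContinuousOn z (Ici t₀) := fun t ht => (hz t ht).continuousWithinAt
  have hcx : ContinuousOn x (Ici t₀) := fun t ht => (hx t ht).continuousWithinAt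
  -- it suffices that `y` converges and that `z ^ 2` tends to zero
  have finish : ∀ l, Tendsto y atTop (𝓝 l) → Tendsto (fun t => z t ^ 2) atTop (𝓝 0) →
      ∃ l, Tendsto x atTop (𝓝 0) ∧ Tendsto y atTop (𝓝 l) ∧ Tendsto z atTop (𝓝 0) := by
    intro l hl hz2
    have sq_zero : ∀ u : ℝ → ℝ, Tendsto (fun t => u t ^ 2) atTop (𝓝 0) → Tendsto u atTop (𝓝 0) := by
      intro u hu
      rw [tendsto_zero_iff_abs_tendsto_zero]
      have := (Real.continuous_sqrt.tendsto 0).comp hu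
      rw [Real.sqrt_zero] at this
      exact this.congr fun t => Real.sqrt_sq_eq_abs _
    refine ⟨l, sq_zero x ?_, hl, sq_zero z hz2⟩
    have := hz2.const_mul (κ ^ 2)
    rw [mul_zero] at this
    refine this.congr' ?_
    filter_upwards [eventually_ge_atTop t₀] with t ht using (hxz t ht).symm
  -- If `s z x` keeps the sign `σ`, then `-σ y` has derivative a positive multiple of `z²`, so it is
  -- monotone and bounded and converges. By energy `z²` converges too, and its limit must be zero,
  -- being that of the derivative up to a factor.
  have hy' : ∀ σ : ℝ, σ ^ 2 = 1 →
      (∀ t ∈ Ici t₀, σ * (s * (z t * x t)) = κ * z t ^ 2) →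
      ∃ l, Tendsto x atTop (𝓝 0) ∧ Tendsto y atTop (𝓝 l) ∧ Tendsto z atTop (𝓝 0) := by
    intro σ hσ hp
    have hu : ∀ t ∈ Ici t₀, HasDerivWithinAt (fun t => -σ * y t)
        ((A - C) * κ / B * z t ^ 2) (Ici t₀) t := by
      intro t ht
      refine ((hy t ht).const_mul (-σ)).congr_deriv ?_
      have := hp t ht
      field_simp
      linear_combination (A - C) * this
    obtain ⟨l, hl⟩ := exists_tendsto_of_deriv_nonneg (C := 1 + E / B) hu
      (fun t _ => by positivity) (fun t ht => by
        refine (le_abs_self _).trans ?_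
        have : |σ| = 1 := by
          rw [← sq_eq_sq₀ (abs_nonneg _) zero_le_one, sq_abs, hσ, one_pow]
        rw [abs_mul, abs_neg, this, one_mul]
        exact hEB t ht)
    have hyl : Tendsto y atTop (𝓝 (-σ * l)) := by
      refine (hl.const_mul (-σ)).congr fun t => ?_
      linear_combination y t * hσ
    have hzl : Tendsto (fun t => z t ^ 2) atTop (𝓝 ((E - B * (-σ * l) ^ 2) / (A * κ ^ 2 + C))) := by
      refine ((tendsto_const_nhds.sub ((hyl.pow 2).const_mul B)).div_const _).congr' ?_
      filter_upwards [eventually_ge_atTop t₀] with t ht using (hzsq t ht).symm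
    have h0 := eq_zero_of_tendsto_of_hasDerivWithinAt hu hl (hzl.const_mul _)
    have : (A - C) * κ / B ≠ 0 := by positivity
    rw [(mul_eq_zero.mp h0).resolve_left this] at hzl
    exact finish _ hyl hzl
  -- Either `z x` vanishes at some time, and Grönwall keeps it zero afterwards since `|(z x)'| ≤ K κ
  -- z² = K |z x|`, or it never vanishes and has constant sign.
  by_cases hzero : ∃ t₁ ∈ Ici t₀, z t₁ * x t₁ = 0
  · obtain ⟨t₁, ht₁, hp⟩ := hzero
    have hsub : Ici t₁ ⊆ Ici t₀ := Ici_subset_Ici.mpr ht₁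
    have hpd : ∀ t ∈ Ici t₀, HasDerivWithinAt (fun t => z t * x t)
        (2 * s * (B - C) / A * y t * z t ^ 2) (Ici t₀) t := by
      intro t ht
      refine ((hz t ht).mul (hx t ht)).congr_deriv ?_
      have := hQ t ht
      field_simp
      linear_combination s * y t * this
    have hz0 : ∀ t ∈ Ici t₁, z t = 0 := by
      intro t ht
      have hK := eq_zero_of_abs_deriv_le_mul_abs_self_of_eq_zero_right
        (f := fun t => z t * x t) (f' := fun t => 2 * s * (B - C) / A * y t * z t ^ 2)
        (K := 2 * (B - C) / A * (1 + E / B) / κ) (a := t₁) (b := t)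
        ((hcz.mul hcx).mono (Icc_subset_Ici_self.trans hsub))
        (fun r hr => (hpd r (hsub hr.1)).mono (Ici_subset_Ici.mpr (hsub hr.1)))
        hp (fun r hr => by
          have hs1 : |s| = 1 := by
            rw [← sq_eq_sq₀ (abs_nonneg _) zero_le_one, sq_abs, hs, one_pow]
          have hyr := hEB r (hsub hr.1)
          rw [Real.norm_eq_abs, Real.norm_eq_abs, habs r (hsub hr.1)]
          simp only [abs_mul, abs_div, hs1, abs_of_pos dBC, abs_of_pos hA, abs_pow, sq_abs,
            abs_two]
          calc 2 * 1 * (B - C) / A * |y r| * z r ^ 2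
              ≤ 2 * 1 * (B - C) / A * (1 + E / B) * z r ^ 2 := by gcongr
            _ = 2 * (B - C) / A * (1 + E / B) / κ * (κ * z r ^ 2) := by field_simp)
        t ⟨ht, le_rfl⟩
      have h1 := habs t (hsub ht)
      rw [hK, abs_zero] at h1
      have := (mul_eq_zero.mp h1.symm).resolve_left hκ0.ne'
      exact pow_eq_zero_iff two_ne_zero |>.mp this
    have hyc : ∀ t, t₁ ≤ t → y t = y t₁ := by
      intro t ht
      refine eq_of_hasDerivWithinAt_zero (isUpperSet_Ici t₁) (fun r hr => ?_) ht self_mem_Ici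
      refine ((hy r (hsub hr)).mono hsub).congr_deriv ?_
      rw [hz0 r hr]
      simp
    refine finish _ (tendsto_of_eqOn_const hyc) (tendsto_of_eqOn_const (t₀ := t₁) fun t ht => ?_)
    rw [hz0 t ht]
    simp
  · push Not at hzero
    have hs0 : s ≠ 0 := by
      rintro rfl
      norm_num at hs
    have hcp : ContinuousOn (fun t => s * (z t * x t)) (Ici t₀) :=
      continuousOn_const.mul (hcz.mul hcx)
    have hne : ∀ t ∈ Ici t₀, s * (z t * x t) ≠ 0 := fun t ht => mul_ne_zero hs0 (hzero t ht)
    have habs' : ∀ t ∈ Ici t₀, |s * (z t * x t)| = κ * z t ^ 2 := by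
      intro t ht
      have hs1 : |s| = 1 := by
        rw [← sq_eq_sq₀ (abs_nonneg _) zero_le_one, sq_abs, hs, one_pow]
      rw [abs_mul, hs1, one_mul, habs t ht]
    have hpre : IsPreconnected (Ici t₀) := isPreconnected_Ici
    rcases (hne t₀ self_mem_Ici).lt_or_gt with hneg | hpos
    · refine hy' (-1) (by norm_num) fun t ht => ?_
      rw [← habs' t ht, abs_of_neg]
      · ring
      · by_contra! hcon
        obtain ⟨r, hr, e⟩ := hpre.intermediate_value self_mem_Ici ht hcp ⟨hneg.le, hcon⟩
        exact hne r hr e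
    · refine hy' 1 (by norm_num) fun t ht => ?_
      rw [← habs' t ht, abs_of_pos]
      · ring
      · by_contra! hcon
        obtain ⟨r, hr, e⟩ := hpre.intermediate_value ht self_mem_Ici hcp ⟨hcon, hpos.le⟩
        exact hne r hr e

/-! ### Convergence of the direction and the equivalence. -/

namespace IsBodySolution

/-- On an extremal level every state is zero or an eigenvector, so the field vanishes and `ω` is
constant; otherwise the level is a separatrix of the middle axis. -/
theorem exists_tendsto_of_level (h : IsBodySolution J I a ω) (hJ : ∀ i, 0 < J i)
    (hI : IsUpperSet I) {t₀ : ℝ} (ht₀ : t₀ ∈ I) {i₀ : Fin 3}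
    (hQ : ∑ i, J i * (J i₀ - J i) * ω t₀ i ^ 2 = 0) : ∃ b, Tendsto ω atTop (𝓝 b) := by
  have hsub : Ici t₀ ⊆ I := fun t ht => hI ht ht₀
  have hQt : ∀ t ∈ I, ∑ i, J i * (J i₀ - J i) * ω t i ^ 2 = 0 := fun t ht =>
    (h.level_eq hJ hI ht ht₀ _).trans hQ
  by_cases hext : (∀ i, J i ≤ J i₀) ∨ ∀ i, J i₀ ≤ J i
  · refine ⟨ω t₀, tendsto_of_eqOn_const (t₀ := t₀) fun t ht => ?_⟩
    funext i
    refine eq_of_hasDerivWithinAt_zero hI (f := fun t => ω t i) (fun r hr => ?_) (hsub ht) ht₀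
    refine (h.euler_apply hr i).congr_deriv ?_
    have e := mul_eq_mul_of_extremal hJ hext (hQt r hr)
    have e01 : (J 0 - J 1) * ω r 0 * ω r 1 = 0 := by
      linear_combination ω r 1 * e 0 - ω r 0 * e 1
    have e12 : (J 1 - J 2) * ω r 1 * ω r 2 = 0 := by
      linear_combination ω r 2 * e 1 - ω r 1 * e 2
    have e20 : (J 2 - J 0) * ω r 2 * ω r 0 = 0 := by
      linear_combination ω r 0 * e 2 - ω r 2 * e 0
    fin_cases i <;> simp [eulerField, e01, e12, e20]
  · obtain ⟨σ, rfl, h01, h12⟩ := exists_perm_of_not_extremal hext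
    obtain ⟨s, hs, hF⟩ := eulerField_perm hJ σ
    obtain ⟨l, hx, hy, hz⟩ := tendsto_of_separatrix (hJ (σ 2)) h12 h01 hs (t₀ := t₀)
      (E := ∑ i, J i * ω t₀ i ^ 2)
      (x := fun t => ω t (σ 0)) (y := fun t => ω t (σ 1)) (z := fun t => ω t (σ 2))
      (fun t ht => ((h.euler_apply (hsub ht) (σ 0)).mono hsub).congr_deriv (hF _).1)
      (fun t ht => ((h.euler_apply (hsub ht) (σ 1)).mono hsub).congr_deriv (hF _).2.1)
      (fun t ht => ((h.euler_apply (hsub ht) (σ 2)).mono hsub).congr_deriv (hF _).2.2)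
      (fun t ht => by rw [← h.energy_eq hJ hI (hsub ht) ht₀, sum_perm σ])
      (fun t ht => by
        have := hQt t (hsub ht)
        rw [sum_perm σ] at this
        linear_combination -this)
    have hlim : ∀ j, ∃ c, Tendsto (fun t => ω t (σ j)) atTop (𝓝 c) := by
      intro j
      fin_cases j
      exacts [⟨0, hx⟩, ⟨l, hy⟩, ⟨0, hz⟩]
    choose c hc using hlim
    refine ⟨fun i => c (σ.symm i), tendsto_pi_nhds.mpr fun i => ?_⟩
    simpa using hc (σ.symm i)

theorem exists_tendsto_direction (h : IsBodySolution J I a ω) (hJ : ∀ i, 0 < J i)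
    (hI : IsUpperSet I) {t₀ : ℝ} (ht₀ : t₀ ∈ I) (hω : InEigenspace J (ω t₀) ∨ OnSingularSet J (ω t₀))
    {k : ℝ} (hk : ∀ i, J i * ω t₀ i = k * a t₀ i) : ∃ b, Tendsto a atTop (𝓝 b) := by
  have hsub : Ici t₀ ⊆ I := fun t ht => hI ht ht₀
  have hkt : ∀ t ∈ I, ∀ i, J i * ω t i = k * a t i := fun t ht =>
    h.momentum_eq_smul hJ hI ht ht₀ hk
  -- For `k = 0` the body is at rest and `a` is constant; otherwise `a = Jω / k` inherits the limit
  -- of `ω`.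
  by_cases hk0 : k = 0
  · refine ⟨a t₀, tendsto_of_eqOn_const (t₀ := t₀) fun t ht => ?_⟩
    funext i
    refine eq_of_hasDerivWithinAt_zero hI (f := fun t => a t i) (fun r hr => ?_) (hsub ht) ht₀
    refine (h.direction_apply hr i).congr_deriv ?_
    have : ω r = 0 := by
      funext j
      have := hkt r hr j
      rw [hk0, zero_mul] at this
      exact (mul_eq_zero.mp this).resolve_left (hJ j).ne'
    simp [this]
  · have hQ : ∃ i₀, ∑ i, J i * (J i₀ - J i) * ω t₀ i ^ 2 = 0 := by
      rcases hω with hω | ⟨σ, h01, h12, hω⟩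
      · obtain ⟨c, hc⟩ := inEigenspace_iff.mp hω
        by_cases h0 : ∃ i, ω t₀ i ≠ 0
        · obtain ⟨i₀, hi₀⟩ := h0
          -- A nonzero coordinate identifies the eigenvalue as a moment of inertia.
          have hci : J i₀ = c := mul_right_cancel₀ hi₀ (hc i₀)
          refine ⟨i₀, Finset.sum_eq_zero fun i _ => ?_⟩
          rw [hci]
          linear_combination -J i * ω t₀ i * hc i
        · push Not at h0
          exact ⟨0, by simp [h0]⟩
      · exact ⟨σ 1, (abs_eq_sqrt_mul_iff σ hJ h01 h12 _).mp hω⟩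
    obtain ⟨i₀, hi₀⟩ := hQ
    obtain ⟨b, hb⟩ := h.exists_tendsto_of_level hJ hI ht₀ hi₀
    refine ⟨fun i => J i * b i / k, tendsto_pi_nhds.mpr fun i => ?_⟩
    refine (((tendsto_pi_nhds.mp hb i).const_mul (J i)).div_const k).congr' ?_
    filter_upwards [eventually_ge_atTop t₀] with t ht
    rw [hkt t (hsub ht) i, mul_div_cancel_left₀ _ hk0]

theorem not_persistentlyExciting_iff (h : IsBodySolution J I a ω) (hJ : ∀ i, 0 < J i)
    (hI : IsUpperSet I) {t₀ : ℝ} (ht₀ : t₀ ∈ I) :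
    ¬ PersistentlyExciting I a ↔ (InEigenspace J (ω t₀) ∨ OnSingularSet J (ω t₀)) ∧
      Aligned (Matrix.diagonal J *ᵥ ω t₀) (a t₀) := by
  simp only [aligned_iff, Matrix.mulVec_diagonal]
  constructor
  · exact h.of_not_persistentlyExciting hJ hI ht₀
  · rintro ⟨hω, k, hk⟩
    obtain ⟨b, hb⟩ := h.exists_tendsto_direction hJ hI ht₀ hω hk
    exact not_persistentlyExciting_of_tendsto hI ⟨t₀, ht₀⟩ h.continuousOn_direction
      (fun t ht => h.sum_direction_sq ht) hb

end IsBodySolution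

/-! ### Genericity. -/

/-- For almost every initial condition the angular momentum is not aligned with a given unit
vector. -/
theorem ae_not_aligned (hJ : ∀ i, 0 < J i) {a₀ : Fin 3 → ℝ} (ha₀ : a₀ ⬝ᵥ a₀ = 1)
    (ν : Measure SO3) :
    ∀ᵐ p ∂(ν.prod (volume : Measure (Fin 3 → ℝ))),
      ¬ Aligned ((p.1 : Matrix (Fin 3) (Fin 3) ℝ) *ᵥ (Matrix.diagonal J *ᵥ p.2)) a₀ := by
  set S : Set (SO3 × (Fin 3 → ℝ)) := {p | crossProduct a₀
    ((p.1 : Matrix (Fin 3) (Fin 3) ℝ) *ᵥ (Matrix.diagonal J *ᵥ p.2)) = 0} with hS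
  have hcont : Continuous fun p : SO3 × (Fin 3 → ℝ) => crossProduct a₀
      ((p.1 : Matrix (Fin 3) (Fin 3) ℝ) *ᵥ (Matrix.diagonal J *ᵥ p.2)) := by
    refine continuous_crossProduct.comp (continuous_const.prodMk ?_)
    exact (continuous_subtype_val.comp continuous_fst).matrix_mulVec
      (continuous_const.matrix_mulVec continuous_snd)
  have hmeas : MeasurableSet S := (isClosed_singleton.preimage hcont).measurableSet
  have hnull : ν.prod volume S = 0 := by
    -- By Fubini it suffices that each slice at fixed `R` is null; it is the kernel of a linear map,
    -- which is proper because `R` and `J` are invertible and `a₀ ≠ 0`.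
    refine (Measure.measure_prod_null hmeas).mpr (Eventually.of_forall fun R => ?_)
    set L : (Fin 3 → ℝ) →ₗ[ℝ] (Fin 3 → ℝ) := (crossProduct a₀).comp
      ((Matrix.mulVecLin (R : Matrix (Fin 3) (Fin 3) ℝ)).comp
        (Matrix.mulVecLin (Matrix.diagonal J))) with hL
    have hslice : Prod.mk R ⁻¹' S = (LinearMap.ker L : Set (Fin 3 → ℝ)) := by
      ext w
      simp [hS, hL]
    change volume (Prod.mk R ⁻¹' S) = 0
    rw [hslice]
    refine Measure.addHaar_submodule _ _ fun htop => ?_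
    have hzero : ∀ v : Fin 3 → ℝ, crossProduct a₀ v = 0 := by
      intro v
      have hmem : (Matrix.diagonal (fun i => (J i)⁻¹) *ᵥ
          ((R : Matrix (Fin 3) (Fin 3) ℝ)ᵀ *ᵥ v)) ∈ LinearMap.ker L := htop ▸ Submodule.mem_top
      have hinv : Matrix.diagonal J * Matrix.diagonal (fun i => (J i)⁻¹) = 1 := by
        rw [Matrix.diagonal_mul_diagonal, ← Matrix.diagonal_one]
        congr 1
        funext i
        exact mul_inv_cancel₀ (hJ i).ne'
      rw [LinearMap.mem_ker] at hmem
      simp only [hL, LinearMap.comp_apply, Matrix.mulVecLin_apply] at hmem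
      rwa [Matrix.mulVec_mulVec _ (Matrix.diagonal J), hinv, Matrix.one_mulVec,
        Matrix.mulVec_mulVec, (transpose_mul_self_of_mem R.2).2, Matrix.one_mulVec] at hmem
    have hsum := sum_crossProduct_sq a₀
    simp only [hzero] at hsum
    -- If `a₀ × v = 0` for all `v`, two basis vectors already give two coordinates of `a₀` with
    -- square `|a₀|² = 1`, a contradiction.
    have h0 := hsum (Pi.single 0 1)
    have h1 := hsum (Pi.single 1 1)
    simp [Fin.sum_univ_three, dotProduct] at h0 h1 ha₀
    nlinarith [sq_nonneg (a₀ 0), sq_nonneg (a₀ 1), sq_nonneg (a₀ 2)]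
  rw [ae_iff]
  refine measure_mono_null ?_ hnull
  rintro p hp
  obtain ⟨c, hc⟩ := not_not.mp hp
  rw [hS, mem_ofPred_eq, hc, map_smul, cross_self, smul_zero]

end RigidBody

theorem theorem3 (J : Fin 3 → ℝ) (hJ : ∀ i, 0 < J i)
    (a₀ : Fin 3 → ℝ) (ha₀ : a₀ ⬝ᵥ a₀ = 1)
    (I : Set ℝ) (hI : IsUpperSet I) (t₀ : ℝ) (ht₀ : t₀ ∈ I) :
    (∀ (ν : Measure RigidBody.SO3) [ν.IsHaarMeasure],
      ∀ᵐ p ∂(ν.prod (volume : Measure (Fin 3 → ℝ))),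
        ∀ (R : ℝ → Matrix (Fin 3) (Fin 3) ℝ) (ω : ℝ → Fin 3 → ℝ),
          RigidBody.IsSolution J (fun _ => 0) I R ω → R t₀ = (p.1 : Matrix (Fin 3) (Fin 3) ℝ) →
          ω t₀ = p.2 → RigidBody.PersistentlyExciting I (fun t => (R t)ᵀ *ᵥ a₀)) ∧
    (∀ (R : ℝ → Matrix (Fin 3) (Fin 3) ℝ) (ω : ℝ → Fin 3 → ℝ),
      RigidBody.IsSolution J (fun _ => 0) I R ω →
      (¬ RigidBody.PersistentlyExciting I (fun t => (R t)ᵀ *ᵥ a₀) ↔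
        (RigidBody.InEigenspace J (ω t₀) ∧
            RigidBody.Aligned (R t₀ *ᵥ (Matrix.diagonal J *ᵥ ω t₀)) a₀) ∨
          (RigidBody.OnSingularSet J (ω t₀) ∧
            RigidBody.Aligned (R t₀ *ᵥ (Matrix.diagonal J *ᵥ ω t₀)) a₀))) := by
  have key : ∀ (R : ℝ → Matrix (Fin 3) (Fin 3) ℝ) (ω : ℝ → Fin 3 → ℝ),
      RigidBody.IsSolution J (fun _ => 0) I R ω →
      (¬ RigidBody.PersistentlyExciting I (fun t => (R t)ᵀ *ᵥ a₀) ↔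
        (RigidBody.InEigenspace J (ω t₀) ∨ RigidBody.OnSingularSet J (ω t₀)) ∧
            RigidBody.Aligned (R t₀ *ᵥ (Matrix.diagonal J *ᵥ ω t₀)) a₀) := by
    intro R ω h
    rw [RigidBody.aligned_mulVec_iff (h.rotation t₀ ht₀)]
    exact (h.isBodySolution hJ ha₀).not_persistentlyExciting_iff hJ hI ht₀
  refine ⟨fun ν _ => ?_, fun R ω h => by rw [key R ω h, or_and_right]⟩
  filter_upwards [RigidBody.ae_not_aligned hJ ha₀ ν] with p hp R ω h hR hω
  by_contra hPE
  refine hp ?_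
  rw [← hR, ← hω]
  exact ((key R ω h).mp hPE).2
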